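/- Let $W\subset\mathbb Z$ be finite. For $w\in L^1(0,1)$ let $\mathrm{TV}(w)\in[0,\infty]$ be its total variation and let $BV_W$ be the set of $w\in L^1(0,1)$ with $\mathrm{TV}(w)<\infty$ and $w(t)\in W$ for a.e. $t$. For $w\in BV_W$ let $t_1<\dots<t_{n(w)}$ in $(0,1)$ be its switching points, i.e. the points where the one-sided limits $w(t^-)$, $w(t^+)$ differ. Fix $n_{\max}\in\mathbb N$ and let $$X=\{w\in BV_W : n(w)\le n_{\max}\},\qquad d(u,v)=\|u-v\|_{L^1(0,1)} .$$ Let $F:L^1(0,1)\to\mathbb R$ be bounded below and differentiable with gradient $\nabla F:L^1(0,1)\to L^\infty(0,1)$, i.e. $F'(w)v=\int_0^1\nabla F(w)\,v\,dt$; assume that $\nabla F$ is Lipschitz continuous and that $\{\nabla F(w): w\in X\}$ is bounded in $W^{1,\infty}(0,1)$. Put $J=F+\mathrm{TV}$ and, using the continuous representative of $\nabla F(w)$, $$\mathcal C(w)=\sum_{i=1}^{n(w)}\bigl|\nabla F(w)(t_i)\,(w(t_i^+)-w(t_i^-))\bigr|\qquad(w\in X).$$ Let $A$ be any feasible set with $X\subset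 A\subset BV_W$ (for instance $A=X$ or $A=BV_W$). For $v\in X$ and $\Delta\ge0$ consider the trust-region subproblem of minimizing $\int_0^1\nabla F(v)(w-v)\,dt+\mathrm{TV}(w)-\mathrm{TV}(v)$ over $w\in A$ with $\|w-v\|_{L^1}\le\Delta$; let $\mathrm{pred}(v,\Delta)$ be minus its optimal value, and let $\mathrm{ared}(v,w)=J(v)-J(w)$. Let $\sigma\in(0,1)$. A run of the trust-region algorithm with maximal radius $\Delta_{\max}\in(0,\infty]$ starts from some $x_0$ and $\Delta_0>0$. In iteration $n$ a solution $\tilde x_n$ of the subproblem at $x_n$ with radius $\Delta_n$ is computed. If $\mathrm{pred}(x_n,\Delta_n)=0$, the run terminates with $x_n$ (and we put $x_{n+1}=x_n$, $\Delta_{n+1}=\Delta_n$, continuing in this way). Otherwise, if $\mathrm{ared}(x_n,\tilde x_n)\ge\sigma\,\mathrm{pred}(x_n,\Delta_n)$, then $x_{n+1}=\tilde x_n$ and $\Delta_{n+1}=\min\{2\Delta_n,\Delta_{\max}\}$; if not, $x_{n+1}=x_n$ and $\Delta_{n+1}=\Delta_n/2$. For a point $z$ put $$R_n(z)=(1-\sigma)\,\mathrm{pred}(x_n,\Delta_n)-\bigl|\mathrm{ared}(x_n,z)-\mathrm{pred}(x_n,\Delta_n)\bigr|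 .$$ Then $\mathrm{pred}(x,\cdot)$ is monotonically increasing on $[0,\infty)$ for every $x\in X$, and there are constants $c_0>0$, $c_1\ge0$, $s\in(0,1)$, $c_2\ge c_1$, $\underline\Delta_b>0$, $\delta>0$, $\underline\Delta_c>0$, $L>0$ and a function $\underline\Delta_a:X\to[0,\infty)$ such that the following hold. 1. $\mathrm{pred}(x,\Delta)\ge c_0\,\mathcal C(x)\,\Delta-c_1\Delta^{1+s}$ for all $x\in X$ and $0\le\Delta\le\underline\Delta_a(x)$. 2. For every run (with any $\Delta_{\max}$, $x_0$, $\Delta_0$) whose iterates lie in $X$, every $n$, and each $z\in\{x_{n+1},\tilde x_n\}$: $R_n(z)\ge(1-\sigma)\bigl(c_0\,\mathcal C(x_n)\Delta_n-c_2\Delta_n^{1+s}\bigr)$ if $\Delta_n\le\underline\Delta_a(x_n)$; $\mathrm{pred}(x_n,\Delta_n)\ge\delta$ if $\underline\Delta_a(x_n)\le\min\{\Delta_n,\underline\Delta_b\}$; $R_n(z)\ge\delta$ if $\underline\Delta_a(x_n)\le\Delta_n\le\underline\Delta_b$. 3. For every such run, every $n$, and each $z\in\{x_{n+1},\tilde x_n\}\cap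 X$ with $d(x_n,z)\le\Delta_n\le\underline\Delta_c$: $\mathrm{pred}(x_n,\Delta_n)\ge\delta$ or $|\mathcal C(x_n)-\mathcal C(z)|\le L\,d(x_n,z)$. -/

import Mathlib

open MeasureTheory Set Filter Topology
open scoped ENNReal NNReal

namespace IntegerControl

noncomputable section

/-! ### Functions on the unit interval -/

/-- Lebesgue measure on the open interval `(0, 1)`. -/
abbrev unitMeasure : Measure ℝ := volume.restrict (Ioo (0 : ℝ) 1)

/-- The space `L¹(0, 1)`; its distance is `‖u - v‖_{L¹(0,1)}`. -/
abbrev L1 : Type := Lp ℝ 1 unitMeasure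

/-- The space `L^∞(0, 1)`. -/
abbrev LInf : Type := Lp ℝ ∞ unitMeasure

/-- The total variation of `w ∈ L¹(0, 1)` in `[0, ∞]`: the infimum of the pointwise variations on
`(0, 1)` of the representatives of `w` (the essential variation). -/
def totalVariation (w : L1) : ℝ≥0∞ :=
  ⨅ (f : ℝ → ℝ) (_ : f =ᵐ[unitMeasure] w), eVariationOn f (Ioo 0 1)

/-- The functions of bounded variation on `(0, 1)` with values in `W` almost everywhere. -/
def BVW (W : Finset ℤ) : Set L1 :=
  {w | totalVariation w < ∞ ∧ ∀ᵐ t ∂unitMeasure, ∃ k ∈ W, w t = (k : ℝ)}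

/-- The right limit `w(t⁺)`. Null sets are ignored, so that the limit depends only on the
equivalence class of `w`. -/
def rightLim (w : L1) (t : ℝ) : ℝ := limUnder (ae unitMeasure ⊓ 𝓝[>] t) w

/-- The left limit `w(t⁻)`, again up to null sets. -/
def leftLim (w : L1) (t : ℝ) : ℝ := limUnder (ae unitMeasure ⊓ 𝓝[<] t) w

/-- The set of switching points `t₁ < … < t_{n(w)}` of `w`. -/
def switches (w : L1) : Set ℝ := {t | t ∈ Ioo (0 : ℝ) 1 ∧ leftLim w t ≠ rightLim w t}

/-- The functions in `BVW W` with at most `nmax` switching points. -/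
def switchSpace (W : Finset ℤ) (nmax : ℕ) : Set L1 :=
  {w | w ∈ BVW W ∧ (switches w).encard ≤ nmax}

/-- `h` is the weak derivative of `g` on `(0, 1)`. -/
def IsWeakDeriv (g h : ℝ → ℝ) : Prop :=
  ∀ φ : ℝ → ℝ, ContDiff ℝ (⊤ : ℕ∞) φ → HasCompactSupport φ → tsupport φ ⊆ Ioo 0 1 →
    ∫ t, g t * deriv φ t ∂unitMeasure = -∫ t, h t * φ t ∂unitMeasure

/-- The family `G` of functions is uniformly bounded in the Sobolev space `W^{1,p}(0, 1)`. -/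
def BoundedInSobolev (p : ℝ≥0∞) (G : Set LInf) : Prop :=
  ∃ M : ℝ, ∀ g ∈ G, ∃ h : ℝ → ℝ, MemLp h p unitMeasure ∧ IsWeakDeriv g h ∧
    eLpNorm g p unitMeasure ≤ ENNReal.ofReal M ∧ eLpNorm h p unitMeasure ≤ ENNReal.ofReal M

/-- The continuous representative of `g` on `(0, 1)` (whose values on `(0, 1)` are unique), if there
is one. -/
def contRep (g : LInf) : ℝ → ℝ :=
  Classical.epsilon fun f : ℝ → ℝ => ContinuousOn f (Ioo 0 1) ∧ f =ᵐ[unitMeasure] g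

/-! ### The integer optimal control problem -/

/-- `F : L¹(0, 1) → ℝ` is (Fréchet) differentiable and `gradF w ∈ L^∞(0, 1)` represents its
derivative at `w`. -/
def IsGradient (F : L1 → ℝ) (gradF : L1 → LInf) : Prop :=
  ∀ w : L1, ∃ F' : L1 →L[ℝ] ℝ, HasFDerivAt F F' w ∧
    ∀ v : L1, F' v = ∫ t, gradF w t * v t ∂unitMeasure

/-- The assumptions on `F` and its gradient, for a set `X` of functions and an exponent `p`. -/
structure GeneralAssumption (F : L1 → ℝ) (gradF : L1 → LInf) (X : Set L1) (p : ℝ≥0∞) : Prop where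
  bddBelow : BddBelow (range F)
  gradient : IsGradient F gradF
  lipschitz : ∃ κ : ℝ≥0, LipschitzWith κ gradF
  bounded : BoundedInSobolev p (gradF '' X)

/-- The objective `J = F + TV` (used where `TV` is finite). -/
def objective (F : L1 → ℝ) (w : L1) : ℝ := F w + (totalVariation w).toReal

/-- The criticality measure `𝒞(w) = ∑ i, |∇F(w)(t_i) (w(t_i⁺) - w(t_i⁻))|`. -/
def criticality (gradF : L1 → LInf) (w : L1) : ℝ :=
  ∑ᶠ t ∈ switches w, |contRep (gradF w) t * (rightLim w t - leftLim w t)|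

/-- The objective `(∇F(v), w - v)_{L²} + TV(w) - TV(v)` of the trust-region subproblem at `v`. -/
def trObjective (gradF : L1 → LInf) (v w : L1) : ℝ :=
  (∫ t, gradF v t * (w t - v t) ∂unitMeasure)
    + (totalVariation w).toReal - (totalVariation v).toReal

/-- The feasible points of the subproblem at `v` with radius `Δ`, for the feasible set `A`. -/
def trFeasible (A : Set L1) (v : L1) (Δ : ℝ) : Set L1 := {w | w ∈ A ∧ dist w v ≤ Δ}

/-- The predicted reduction: minus the optimal value of the trust-region subproblem. -/
def predicted (gradF : L1 → LInf) (A : Set L1) (v : L1) (Δ : ℝ) : ℝ :=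
  -sInf (trObjective gradF v '' trFeasible A v Δ)

/-- The set of solutions of the trust-region subproblem. -/
def trSolutions (gradF : L1 → LInf) (A : Set L1) (v : L1) (Δ : ℝ) : Set L1 :=
  {w | w ∈ trFeasible A v Δ ∧ IsMinOn (trObjective gradF v) (trFeasible A v Δ) w}

/-! ### The abstract trust-region algorithm -/

/-- A run of the trust-region algorithm for the objective `J`, the predicted reduction `pred` and
the solution sets `sol` of the subproblems: `x n` are the iterates, `y n` the computed trial points,
`Δ n` the trust-region radii. When `pred (x n) (Δ n) = 0` the algorithm terminates and returns
`x n`; the sequences are then continued by the constant ones. -/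
structure IsRun {E : Type*} (J : E → ℝ) (pred : E → ℝ → ℝ) (sol : E → ℝ → Set E)
    (σ : ℝ) (Δmax : EReal) (x y : ℕ → E) (Δ : ℕ → ℝ) : Prop where
  radius_pos : 0 < Δ 0
  trial : ∀ n, y n ∈ sol (x n) (Δ n)
  terminate : ∀ n, pred (x n) (Δ n) = 0 → x (n + 1) = x n ∧ Δ (n + 1) = Δ n
  accept : ∀ n, pred (x n) (Δ n) ≠ 0 → σ * pred (x n) (Δ n) ≤ J (x n) - J (y n) →
    x (n + 1) = y n ∧ ((Δ (n + 1) : ℝ) : EReal) = min ((2 * Δ n : ℝ) : EReal) Δmax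
  reject : ∀ n, pred (x n) (Δ n) ≠ 0 → J (x n) - J (y n) < σ * pred (x n) (Δ n) →
    x (n + 1) = x n ∧ Δ (n + 1) = Δ n / 2

/-- The remainder `(1 - σ) pred(x, Δ) - |ared(x, z) - pred(x, Δ)|` with `ared(x, z) = J x - J z`. -/
def remainder {E : Type*} (J : E → ℝ) (pred : E → ℝ → ℝ) (σ : ℝ) (x z : E) (Δ : ℝ) : ℝ :=
  (1 - σ) * pred x Δ - |(J x - J z) - pred x Δ|

/-- The structural assumption of the convergence analysis, on the metric space `X` (a subset of a
metric space `E`) and the runs of the algorithm whose iterates lie in `X`.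
The constants do not depend on the run or on `Δmax`. The statements about two
subsequent iterates `x n`, `x (n + 1)` are also made for the computed trial point `y n` in place of
`x (n + 1)`; the two differ when the trial point is rejected. -/
def JumpNonsmoothness {E : Type*} [MetricSpace E] (X : Set E) (C J : E → ℝ)
    (pred : E → ℝ → ℝ) (sol : E → ℝ → Set E) (σ : ℝ) : Prop :=
  (∀ x ∈ X, MonotoneOn (pred x) (Ici 0)) ∧
  ∃ (c₀ c₁ s : ℝ) (Δa : E → ℝ),
    0 < c₀ ∧ 0 ≤ c₁ ∧ 0 < s ∧ s < 1 ∧ (∀ x ∈ X, 0 ≤ Δa x) ∧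
    (∀ x ∈ X, ∀ Δ : ℝ, 0 ≤ Δ → Δ ≤ Δa x → c₀ * C x * Δ - c₁ * Δ ^ (1 + s) ≤ pred x Δ) ∧
  ∃ c₂ Δb δ : ℝ,
    c₁ ≤ c₂ ∧ 0 < Δb ∧ 0 < δ ∧
    (∀ (Δmax : EReal) (x y : ℕ → E) (Δ : ℕ → ℝ), 0 < Δmax →
      IsRun J pred sol σ Δmax x y Δ → (∀ n, x n ∈ X) → ∀ n,
        (∀ z, z = x (n + 1) ∨ z = y n → Δ n ≤ Δa (x n) →
          (1 - σ) * (c₀ * C (x n) * Δ n - c₂ * Δ n ^ (1 + s))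
            ≤ remainder J pred σ (x n) z (Δ n)) ∧
        (Δa (x n) ≤ min (Δ n) Δb → δ ≤ pred (x n) (Δ n)) ∧
        (∀ z, z = x (n + 1) ∨ z = y n → Δa (x n) ≤ Δ n → Δ n ≤ Δb →
          δ ≤ remainder J pred σ (x n) z (Δ n))) ∧
  ∃ Δc L : ℝ,
    0 < Δc ∧ 0 < L ∧
    (∀ (Δmax : EReal) (x y : ℕ → E) (Δ : ℕ → ℝ), 0 < Δmax →
      IsRun J pred sol σ Δmax x y Δ → (∀ n, x n ∈ X) → ∀ n,
        ∀ z ∈ X, z = x (n + 1) ∨ z = y n → dist (x n) z ≤ Δ n → Δ n ≤ Δc →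
          δ ≤ pred (x n) (Δ n) ∨ |C (x n) - C z| ≤ L * dist (x n) z)

end

end IntegerControl

namespace IntegerControl

noncomputable section

/-! Every element of `BVW W` is a step function with finitely many integer jumps, so its total
variation is an integer. Two kinds of competitor in the subproblem at `x` give lower bounds for the
predicted reduction. The first shifts each jump in its descent direction, which costs no variation
and gains a fixed multiple of `criticality` times `Δ`, up to a quadratic error
(`IsSwitchRep.le_predicted`). The second flattens a bump, i.e. a plateau on which `x` has a local
extremum: the variation drops by at least 1, and the gradient term costs at most `M` times the area
removed (`IsBump.le_predicted`).

The threshold radius is `D` times the length of the shortest bump, truncated at 1, where `D` bounds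
the differences of elements of `W`. Below it, jumps can be shifted without changing their order:
jumps of opposite sign are separated by a bump, and for jumps of equal sign the displacement is a
1-Lipschitz function of the position, because the gradient is `M`-Lipschitz. Above it, the shortest
bump fits into the trust region and can be flattened (`exists_radius`). Taylor's formula bounds the
difference of actual and predicted reduction by `κ * Δ ^ 2`, which turns the bounds for `predicted`
into bounds for `remainder`.

For the continuity of `criticality` along a step, suppose that the predicted reduction is small.
Integrality forces the trial point `y` to have the same total variation as `x`. Moreover `y` must
reach the extremal value of `x` somewhere on every bump, since otherwise flattening that bump would
be feasible and profitable. These two facts imply that the cumulative variations of `x` and `y`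
differ pointwise by at most `|x - y|` (`abs_stepVar_sub_le`). Since `criticality` integrates the
absolute value of the gradient against the variation measure, summation by parts bounds the change
by `M` times the distance, and the Lipschitz continuity of `gradF` accounts for the change of the
gradient (`le_predicted_or_abs_criticality_sub_le`). -/

/-! ### Weak derivatives and Lipschitz representatives. -/

lemma exists_Icc_of_tsupport_subset {φ : ℝ → ℝ} (hc : HasCompactSupport φ)
    (hs : tsupport φ ⊆ Ioo 0 1) : ∃ a b : ℝ, 0 < a ∧ a < b ∧ b < 1 ∧ tsupport φ ⊆ Ioo a b := by
  rcases (tsupport φ).eq_empty_or_nonempty with h | h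
  · exact ⟨1 / 3, 1 / 2, by norm_num, by norm_num, by norm_num, by simp [h]⟩
  · obtain ⟨a, ha, ha'⟩ := IsCompact.exists_isLeast hc h
    obtain ⟨b, hb, hb'⟩ := IsCompact.exists_isGreatest hc h
    have h1 := hs ha
    have h2 := hs hb
    have h3 := ha' hb
    refine ⟨a / 2, (b + 1) / 2, by linarith [h1.1], by linarith [h2.1, h1.2, h2.2],
      by linarith [h2.2],
      fun t ht => ⟨?_, ?_⟩⟩
    · linarith [ha' ht, h1.1]
    · linarith [hb' ht, h2.2]

/-- A test function of mean zero has a primitive which is a test function. -/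
lemma exists_primitive_test {θ : ℝ → ℝ} (hθ : ContDiff ℝ (⊤ : ℕ∞) θ) (hc : HasCompactSupport θ)
    (hs : tsupport θ ⊆ Ioo 0 1) (h0 : ∫ t, θ t = 0) :
    ∃ φ : ℝ → ℝ, ContDiff ℝ (⊤ : ℕ∞) φ ∧ HasCompactSupport φ ∧ tsupport φ ⊆ Ioo 0 1 ∧
      deriv φ = θ := by
  obtain ⟨a, b, ha, hab, hb, hsub⟩ := exists_Icc_of_tsupport_subset hc hs
  have hd : ∀ t, HasDerivAt (fun t => ∫ u in (0 : ℝ)..t, θ u) (θ t) t := fun t =>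
    intervalIntegral.integral_hasDerivAt_right (hθ.continuous.intervalIntegrable _ _)
      hθ.continuous.stronglyMeasurable.stronglyMeasurableAtFilter hθ.continuous.continuousAt
  have hderiv : deriv (fun t => ∫ u in (0 : ℝ)..t, θ u) = θ := funext fun t => (hd t).deriv
  have hz : ∀ t, t ∉ Ioo a b → θ t = 0 := fun t ht =>
    image_eq_zero_of_notMem_tsupport fun h => ht (hsub h)
  have hsupp : Function.support (fun t => ∫ u in (0 : ℝ)..t, θ u) ⊆ Icc a b := by
    intro t ht
    by_contra hcon
    apply ht
    rw [mem_Icc, not_and_or, not_le, not_le] at hcon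
    rcases hcon with h | h
    · refine intervalIntegral.integral_zero_ae (Eventually.of_forall fun u hu => hz u ?_)
      rintro ⟨h1, -⟩
      rcases mem_uIoc.1 hu with h2 | h2 <;> linarith [h2.2]
    · have : ∫ u in (0 : ℝ)..t, θ u = ∫ u, θ u := by
        apply intervalIntegral.integral_eq_integral_of_support_subset
        intro u hu
        have : u ∈ Ioo a b := by
          by_contra h'
          exact hu (hz u h')
        exact ⟨by linarith [this.1], by linarith [this.2]⟩
      exact this.trans h0
  have hts : tsupport (fun t => ∫ u in (0 : ℝ)..t, θ u) ⊆ Icc a b :=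
    closure_minimal hsupp isClosed_Icc
  refine ⟨_, ?_, HasCompactSupport.of_support_subset_isCompact isCompact_Icc hsupp,
    hts.trans fun t ht => ⟨by linarith [ht.1], by linarith [ht.2]⟩, hderiv⟩
  rw [contDiff_infty_iff_deriv, hderiv]
  exact ⟨fun t => (hd t).differentiableAt, hθ⟩

lemma ae_unitMeasure_iff {p : ℝ → Prop} :
    (∀ᵐ t ∂unitMeasure, p t) ↔ ∀ᵐ t, t ∈ Ioo (0 : ℝ) 1 → p t :=
  ae_restrict_iff' measurableSet_Ioo

lemma integral_unitMeasure (f : ℝ → ℝ) : ∫ t, f t ∂unitMeasure = ∫ t in (0 : ℝ)..1, f t := by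
  rw [intervalIntegral.integral_of_le zero_le_one, integral_Ioc_eq_integral_Ioo]

/-- A function with a bounded weak derivative has a Lipschitz continuous representative. -/
lemma exists_lipschitz_of_isWeakDeriv {g h : ℝ → ℝ} {M : ℝ} (hM : 0 ≤ M)
    (hg : Integrable g unitMeasure) (hh : Integrable h unitMeasure)
    (hb : ∀ᵐ t ∂unitMeasure, |h t| ≤ M) (hw : IsWeakDeriv g h) :
    ∃ G : ℝ → ℝ, LipschitzWith M.toNNReal G ∧ G =ᵐ[unitMeasure] g := by
  -- Extension by zero keeps the bound on all of `ℝ`, so that the primitive `H` is Lipschitz on the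
  -- whole line.
  set h' : ℝ → ℝ := (Ioo (0 : ℝ) 1).indicator h with hh'
  have hi : Integrable h' := (integrable_indicator_iff measurableSet_Ioo).2 hh
  have hb' : ∀ᵐ t, |h' t| ≤ M := by
    filter_upwards [ae_unitMeasure_iff.1 hb] with t ht
    by_cases hmem : t ∈ Ioo (0 : ℝ) 1
    · simpa [hh', hmem] using ht hmem
    · simpa [hh', hmem] using hM
  set H : ℝ → ℝ := fun t => ∫ u in (0 : ℝ)..t, h' u with hH
  have hHL : LipschitzWith M.toNNReal H := by
    refine LipschitzWith.of_dist_le_mul fun s t => ?_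
    rw [Real.dist_eq, Real.dist_eq, Real.coe_toNNReal _ hM]
    have : H s - H t = ∫ u in t..s, h' u :=
      intervalIntegral.integral_interval_sub_left hi.intervalIntegrable hi.intervalIntegrable
    rw [this]
    exact intervalIntegral.norm_integral_le_of_norm_le_const_ae (f := h')
      (hb'.mono fun u hu _ => hu)
  have hHd : ∀ᵐ t, HasDerivAt H (h' t) t := by
    filter_upwards [LocallyIntegrable.ae_hasDerivAt_integral hi.locallyIntegrable] with t ht
    exact ht 0
  have hHi : Integrable H unitMeasure :=
    (hHL.continuous.locallyIntegrable.integrableOn_isCompact isCompact_Icc).mono_set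
      Ioo_subset_Icc_self
  -- `H` is absolutely continuous, so integration by parts applies to it and `g - H` annihilates all
  -- derivatives of test functions.
  have hparts : ∀ φ : ℝ → ℝ, ContDiff ℝ (⊤ : ℕ∞) φ → HasCompactSupport φ → tsupport φ ⊆ Ioo 0 1 →
      ∫ t, (g t - H t) * deriv φ t ∂unitMeasure = 0 := by
    intro φ hφ hc hs
    have hz : ∀ t, t ∉ Ioo (0 : ℝ) 1 → φ t = 0 := fun t ht =>
      image_eq_zero_of_notMem_tsupport fun h => ht (hs h)
    have hφ1 : ContDiff ℝ 1 φ := hφ.of_le (by exact_mod_cast le_top)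
    have h1 := AbsolutelyContinuousOnInterval.integral_mul_deriv_eq_deriv_mul
      (hHL.lipschitzOnWith (s := uIcc 0 1)).absolutelyContinuousOnInterval
      (hφ1.contDiffOn (s := uIcc 0 1)).absolutelyContinuousOnInterval
    rw [hz 0 (by simp), hz 1 (by simp), ← integral_unitMeasure, ← integral_unitMeasure] at h1
    have h2 : ∫ t, deriv H t * φ t ∂unitMeasure = ∫ t, h t * φ t ∂unitMeasure := by
      refine integral_congr_ae (ae_unitMeasure_iff.2 ?_)
      filter_upwards [hHd] with t ht hmem
      rw [ht.deriv, hh', indicator_of_mem hmem]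
    have h3 := hw φ hφ hc hs
    have hdc : Continuous (deriv φ) := hφ1.continuous_deriv le_rfl
    obtain ⟨K, hK⟩ := (hc.deriv).exists_bound_of_continuous hdc
    have hgi := hg.mul_bdd (c := K) hdc.aestronglyMeasurable (Eventually.of_forall hK)
    have hHi' := hHi.mul_bdd (c := K) hdc.aestronglyMeasurable (Eventually.of_forall hK)
    simp_rw [sub_mul]
    rw [integral_sub hgi hHi', h1, h2, h3]
    ring
  set ρ : ContDiffBump (1 / 2 : ℝ) := ⟨1 / 8, 1 / 4, by norm_num, by norm_num⟩ with hρ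
  set r : ℝ → ℝ := ρ.normed volume with hr
  have hrs : tsupport r ⊆ Ioo 0 1 := by
    rw [hr, ρ.tsupport_normed_eq, Real.closedBall_eq_Icc]
    intro t ht
    simp only [hρ, mem_Icc] at ht
    exact ⟨by linarith [ht.1], by linarith [ht.2]⟩
  have hrd : ContDiff ℝ (⊤ : ℕ∞) r := ρ.contDiff_normed
  have hrc : HasCompactSupport r := ρ.hasCompactSupport_normed
  set c : ℝ := ∫ t, (g t - H t) * r t ∂unitMeasure with hcdef
  have hmul : ∀ ψ : ℝ → ℝ, Continuous ψ → HasCompactSupport ψ →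
      Integrable (fun t => (g t - H t) * ψ t) unitMeasure := by
    intro ψ hψ hc
    obtain ⟨K, hK⟩ := hc.exists_bound_of_continuous hψ
    exact (hg.sub hHi).mul_bdd (c := K) hψ.aestronglyMeasurable (Eventually.of_forall hK)
  -- Du Bois-Reymond: subtracting the multiple `m * r` of a fixed normalized bump gives `ψ` mean
  -- zero, hence a primitive that is a test function. The constant `c` is the value of `g - H` on
  -- `r`.
  have hzero : ∀ᵐ t, t ∈ Ioo (0 : ℝ) 1 → g t - H t - c = 0 := by
    have hloc : IntegrableOn (fun t => g t - H t - c) (Ioo 0 1) :=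
      (hg.sub hHi).sub (integrable_const c)
    refine isOpen_Ioo.ae_eq_zero_of_integral_contDiff_smul_eq_zero hloc.locallyIntegrableOn
      fun ψ hψ hψc hψs => ?_
    have hψi : Integrable ψ := hψ.continuous.integrable_of_hasCompactSupport hψc
    have hri : Integrable r := hrd.continuous.integrable_of_hasCompactSupport hrc
    set m : ℝ := ∫ t, ψ t with hm
    have hmψ : ∫ t, ψ t ∂unitMeasure = m := by
      rw [hm, setIntegral_eq_integral_of_forall_compl_eq_zero]
      exact fun t ht => image_eq_zero_of_notMem_tsupport fun h => ht (hψs h)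
    obtain ⟨φ, h1, h2, h3, h4⟩ := exists_primitive_test (θ := fun t => ψ t - m * r t)
      (hψ.sub (contDiff_const.mul hrd)) (hψc.sub (hrc.mul_left (f := fun _ => m)))
      ((tsupport_sub _ _).trans (union_subset hψs
        ((tsupport_mul_subset_right (f := fun _ => m)).trans hrs)))
      (by rw [integral_sub hψi (hri.const_mul m), integral_const_mul, ρ.integral_normed]; simp [hm])
    have h5 := hparts φ h1 h2 h3
    rw [h4] at h5
    have h6 : ∀ t, (g t - H t) * (ψ t - m * r t)
        = (g t - H t) * ψ t - m * ((g t - H t) * r t) := fun t => by ring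
    simp_rw [h6] at h5
    rw [integral_sub (hmul ψ hψ.continuous hψc) ((hmul r hrd.continuous hrc).const_mul m),
      integral_const_mul, ← hcdef] at h5
    have h7 : ∀ t, ψ t • (g t - H t - c) = (g t - H t) * ψ t - c * ψ t := fun t => by
      rw [smul_eq_mul]; ring
    rw [setIntegral_eq_integral_of_forall_compl_eq_zero
      (s := Ioo 0 1) (f := fun t => ψ t • (g t - H t - c)) ?_ |>.symm]
    · simp_rw [h7]
      rw [integral_sub (hmul ψ hψ.continuous hψc) (hψi.restrict.const_mul c),
        integral_const_mul, hmψ]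
      linarith
    · intro t ht
      rw [image_eq_zero_of_notMem_tsupport fun h => ht (hψs h), zero_smul]
  refine ⟨fun t => H t + c, by simpa using hHL.add (LipschitzWith.const c), ?_⟩
  refine ae_unitMeasure_iff.2 (hzero.mono fun t ht hmem => ?_)
  have := ht hmem
  simp only
  linarith

/-! ### The pairing of `LInf` with `L1`, and Taylor's formula. -/

lemma ae_abs_le_norm (g : LInf) : ∀ᵐ t ∂unitMeasure, |g t| ≤ ‖g‖ := by
  have h := ae_le_eLpNormEssSup (f := g) (μ := unitMeasure)
  rw [← eLpNorm_exponent_top] at h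
  filter_upwards [h] with t ht
  rw [Lp.norm_def, ← Real.norm_eq_abs, ← toReal_enorm]
  exact ENNReal.toReal_mono (Lp.eLpNorm_ne_top g) ht

lemma norm_L1_eq (v : L1) : ‖v‖ = ∫ t, |v t| ∂unitMeasure := L1.norm_eq_integral_norm v

lemma integrable_mul (g : LInf) (v : L1) : Integrable (fun t => g t * v t) unitMeasure :=
  (L1.integrable_coeFn v).bdd_mul (Lp.aestronglyMeasurable g) (ae_abs_le_norm g)

lemma abs_integral_mul_le (g : LInf) (v : L1) :
    |∫ t, g t * v t ∂unitMeasure| ≤ ‖g‖ * ‖v‖ := by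
  rw [norm_L1_eq, ← integral_const_mul, ← Real.norm_eq_abs]
  refine norm_integral_le_of_norm_le ((L1.integrable_coeFn v).norm.const_mul ‖g‖) ?_
  filter_upwards [ae_abs_le_norm g] with t ht
  rw [norm_mul]
  exact mul_le_mul_of_nonneg_right ht (norm_nonneg _)

lemma integral_mul_sub_eq (g : LInf) (v w : L1) :
    ∫ t, g t * (w t - v t) ∂unitMeasure = ∫ t, g t * (w - v : L1) t ∂unitMeasure := by
  refine integral_congr_ae ?_
  filter_upwards [Lp.coeFn_sub w v] with t ht
  rw [ht, Pi.sub_apply]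

lemma abs_integral_mul_sub_le (g : LInf) (v w : L1) :
    |∫ t, g t * (w t - v t) ∂unitMeasure| ≤ ‖g‖ * dist w v := by
  rw [integral_mul_sub_eq, dist_eq_norm]
  exact abs_integral_mul_le g _

lemma dist_L1_eq {v w : L1} {f h : ℝ → ℝ} (hv : v =ᵐ[unitMeasure] f) (hw : w =ᵐ[unitMeasure] h) :
    dist v w = ∫ t, |f t - h t| ∂unitMeasure := by
  rw [dist_eq_norm, norm_L1_eq]
  refine integral_congr_ae ?_
  filter_upwards [Lp.coeFn_sub v w, hv, hw] with t h1 h2 h3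
  rw [h1, Pi.sub_apply, h2, h3]

/-- The mean value inequality on the ball around `v` through `w`, where the derivative varies by at
most `κ * dist w v`. The sharper factor `κ / 2` is not needed. -/
lemma taylor_bound {F : L1 → ℝ} {gradF : L1 → LInf} (hF : IsGradient F gradF) {κ : ℝ≥0}
    (hκ : LipschitzWith κ gradF) (v w : L1) :
    |F w - F v - ∫ t, gradF v t * (w t - v t) ∂unitMeasure| ≤ κ * dist w v ^ 2 := by
  choose F' hF' hF'i using hF
  have hb : ∀ u ∈ Metric.closedBall v (dist w v), ‖F' u - F' v‖ ≤ κ * dist w v := by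
    intro u hu
    refine ContinuousLinearMap.opNorm_le_bound _ (by positivity) fun z => ?_
    have h1 : (F' u - F' v) z = ∫ t, (gradF u - gradF v : LInf) t * z t ∂unitMeasure := by
      rw [sub_apply, hF'i, hF'i, ← integral_sub (integrable_mul _ _)
        (integrable_mul _ _)]
      refine integral_congr_ae ?_
      filter_upwards [Lp.coeFn_sub (gradF u) (gradF v)] with t ht
      rw [ht, Pi.sub_apply, sub_mul]
    rw [h1]
    refine (abs_integral_mul_le _ _).trans (mul_le_mul_of_nonneg_right ?_ (norm_nonneg _))
    rw [← dist_eq_norm]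
    exact (hκ.dist_le_mul u v).trans (mul_le_mul_of_nonneg_left hu κ.2)
  have h := (convex_closedBall v (dist w v)).norm_image_sub_le_of_norm_hasFDerivWithin_le'
    (fun u _ => (hF' u).hasFDerivWithinAt) hb (Metric.mem_closedBall_self dist_nonneg)
    (Metric.mem_closedBall.2 le_rfl)
  rw [hF'i v, Real.norm_eq_abs, ← integral_mul_sub_eq, ← dist_eq_norm] at h
  linarith [h]

/-- One constant serves as norm bound and as Lipschitz constant. The choice made in `contRep` is
harmless because continuous functions that agree almost everywhere on an open set agree there. -/
lemma exists_gradient_bound {F : L1 → ℝ} {gradF : L1 → LInf} {X : Set L1}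
    (hF : GeneralAssumption F gradF X ∞) :
    ∃ M : ℝ, 1 ≤ M ∧ ∀ w ∈ X, ‖gradF w‖ ≤ M ∧ ∃ G : ℝ → ℝ, LipschitzWith M.toNNReal G ∧
      G =ᵐ[unitMeasure] gradF w ∧ EqOn (contRep (gradF w)) G (Ioo 0 1) := by
  obtain ⟨M, hM⟩ := hF.bounded
  -- The bound in the hypothesis may be nonpositive; truncation at 1 allows division by the constant
  -- and later forces `Δb < 1`.
  refine ⟨max M 1, le_max_right _ _, fun w hw => ?_⟩
  obtain ⟨h, hh, hwd, hb1, hb2⟩ := hM (gradF w) (mem_image_of_mem _ hw)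
  have hM0 : (0 : ℝ) ≤ max M 1 := zero_le_one.trans (le_max_right _ _)
  have hMle : ENNReal.ofReal M ≤ ENNReal.ofReal (max M 1) :=
    ENNReal.ofReal_le_ofReal (le_max_left _ _)
  have hha : ∀ᵐ t ∂unitMeasure, |h t| ≤ max M 1 := by
    have h1 := ae_le_eLpNormEssSup (f := h) (μ := unitMeasure)
    rw [← eLpNorm_exponent_top] at h1
    filter_upwards [h1] with t ht
    rw [← Real.norm_eq_abs, ← toReal_enorm]
    exact ENNReal.toReal_le_of_le_ofReal hM0 (ht.trans (hb2.trans hMle))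
  obtain ⟨G, hGL, hG⟩ := exists_lipschitz_of_isWeakDeriv hM0
    ((Lp.memLp (gradF w)).integrable le_top) (hh.integrable le_top) hha hwd
  refine ⟨?_, G, hGL, hG, ?_⟩
  · rw [Lp.norm_def]
    exact ENNReal.toReal_le_of_le_ofReal hM0 (hb1.trans hMle)
  · have hs : ContinuousOn (contRep (gradF w)) (Ioo 0 1) ∧
        contRep (gradF w) =ᵐ[unitMeasure] gradF w :=
      Classical.epsilon_spec (p := fun f : ℝ → ℝ => ContinuousOn f (Ioo 0 1) ∧
        f =ᵐ[unitMeasure] gradF w) ⟨G, hGL.continuous.continuousOn, hG⟩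
    exact Measure.eqOn_open_of_ae_eq (hs.2.trans hG.symm) isOpen_Ioo hs.1
      hGL.continuous.continuousOn

/-! ### Elementary properties of the predicted reduction. -/

section Predicted

variable {gradF : L1 → LInf} {A : Set L1} {v w : L1} {Δ : ℝ}

/-- This makes the real `sInf` in `predicted` a genuine infimum instead of a default value. -/
lemma bddBelow_trObjective (gradF : L1 → LInf) (A : Set L1) (v : L1) (Δ : ℝ) :
    BddBelow (trObjective gradF v '' trFeasible A v Δ) := by
  refine ⟨-(‖gradF v‖ * Δ) - (totalVariation v).toReal, ?_⟩
  rintro _ ⟨w, hw, rfl⟩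
  have h1 := (abs_le.1 (abs_integral_mul_sub_le (gradF v) v w)).1
  have h2 := mul_le_mul_of_nonneg_left hw.2 (norm_nonneg (gradF v))
  have h3 : 0 ≤ (totalVariation w).toReal := ENNReal.toReal_nonneg
  simp only [trObjective]
  linarith

lemma neg_trObjective_le_predicted (hw : w ∈ A) (hd : dist w v ≤ Δ) :
    -trObjective gradF v w ≤ predicted gradF A v Δ :=
  neg_le_neg (csInf_le (bddBelow_trObjective gradF A v Δ) (mem_image_of_mem _ ⟨hw, hd⟩))

lemma predicted_nonneg (hv : v ∈ A) (hΔ : 0 ≤ Δ) : 0 ≤ predicted gradF A v Δ := by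
  have h := neg_trObjective_le_predicted (gradF := gradF) hv (by simpa using hΔ : dist v v ≤ Δ)
  simpa [trObjective] using h

lemma monotoneOn_predicted (hv : v ∈ A) : MonotoneOn (predicted gradF A v) (Ici 0) := by
  intro a ha b _ hab
  refine neg_le_neg (csInf_le_csInf (bddBelow_trObjective gradF A v b) ?_ ?_)
  · exact ⟨_, mem_image_of_mem _ ⟨hv, by simpa using ha⟩⟩
  · exact image_mono fun w hw => ⟨hw.1, hw.2.trans hab⟩

lemma predicted_eq (hw : w ∈ trSolutions gradF A v Δ) :
    predicted gradF A v Δ = -trObjective gradF v w := by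
  have h : IsLeast (trObjective gradF v '' trFeasible A v Δ) (trObjective gradF v w) := by
    refine ⟨mem_image_of_mem _ hw.1, ?_⟩
    rintro _ ⟨u, hu, rfl⟩
    exact hw.2 hu
  rw [predicted, h.csInf_eq]

end Predicted

/-! ### Step functions and their cumulative variation. -/

/-- The left-continuous step function with initial value `a` and jump `J p` at each `p ∈ P`. -/
def stepFun (a : ℤ) (P : Finset ℝ) (J : ℝ → ℤ) (t : ℝ) : ℤ := a + ∑ p ∈ P with p < t, J p

/-- The variation on `(-∞, t)` of the step function with jumps `J p` at `p ∈ P`. -/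
def stepVar (P : Finset ℝ) (J : ℝ → ℤ) (t : ℝ) : ℤ := stepFun 0 P (fun p => |J p|) t

/-- `w` is represented by a step function. -/
def IsStep (a : ℤ) (P : Finset ℝ) (J : ℝ → ℤ) (w : L1) : Prop :=
  w =ᵐ[unitMeasure] fun t => (stepFun a P J t : ℝ)

section StepFun

variable {a : ℤ} {P : Finset ℝ} {J : ℝ → ℤ} {s t : ℝ}

lemma stepFun_eq_sum_ite (a : ℤ) (P : Finset ℝ) (J : ℝ → ℤ) (t : ℝ) :
    stepFun a P J t = a + ∑ p ∈ P, if p < t then J p else 0 := by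
  rw [stepFun, Finset.sum_filter]

lemma stepFun_congr (h : ∀ p ∈ P, p < s ↔ p < t) : stepFun a P J s = stepFun a P J t := by
  rw [stepFun, stepFun, Finset.filter_congr h]

lemma stepFun_sub (hst : s ≤ t) :
    stepFun a P J t - stepFun a P J s = ∑ p ∈ P with s ≤ p ∧ p < t, J p := by
  simp only [stepFun, Finset.sum_filter, add_sub_add_left_eq_sub, ← Finset.sum_sub_distrib]
  refine Finset.sum_congr rfl fun p _ => ?_
  by_cases h1 : p < s
  · have h2 : p < t := h1.trans_le hst
    have h3 : ¬ (s ≤ p ∧ p < t) := fun h => absurd h.1 (not_le.2 h1)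
    rw [if_pos h1, if_pos h2, if_neg h3, sub_self]
  · rw [if_neg h1, sub_zero]
    simp [not_lt.1 h1]

lemma stepVar_mono (P : Finset ℝ) (J : ℝ → ℤ) : Monotone (stepVar P J) := by
  intro s t hst
  rw [← sub_nonneg, stepVar, stepVar, stepFun_sub hst]
  exact Finset.sum_nonneg fun p _ => abs_nonneg _

lemma abs_stepFun_sub_le (hst : s ≤ t) :
    |stepFun a P J t - stepFun a P J s| ≤ stepVar P J t - stepVar P J s := by
  rw [stepVar, stepVar, stepFun_sub hst, stepFun_sub hst]
  exact Finset.abs_sum_le_sum_abs _ _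

lemma stepVar_nonneg (P : Finset ℝ) (J : ℝ → ℤ) (t : ℝ) : 0 ≤ stepVar P J t := by
  rw [stepVar, stepFun, zero_add]
  exact Finset.sum_nonneg fun p _ => abs_nonneg _

lemma stepVar_le (P : Finset ℝ) (J : ℝ → ℤ) (t : ℝ) : stepVar P J t ≤ ∑ p ∈ P, |J p| := by
  rw [stepVar, stepFun, zero_add]
  exact Finset.sum_le_sum_of_subset_of_nonneg (Finset.filter_subset _ _)
    fun p _ _ => abs_nonneg _

lemma stepVar_eq_of_forall_lt (h : ∀ p ∈ P, p < t) : stepVar P J t = ∑ p ∈ P, |J p| := by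
  rw [stepVar, stepFun, zero_add, Finset.filter_true_of_mem h]

lemma stepVar_eq_zero (h : ∀ p ∈ P, t ≤ p) : stepVar P J t = 0 := by
  rw [stepVar, stepFun, zero_add, Finset.filter_false_of_mem fun p hp => not_lt.2 (h p hp),
    Finset.sum_empty]

lemma measurable_stepFun (a : ℤ) (P : Finset ℝ) (J : ℝ → ℤ) :
    Measurable fun t => (stepFun a P J t : ℝ) := by
  simp only [stepFun_eq_sum_ite, Int.cast_add, Int.cast_sum]
  refine measurable_const.add (Finset.measurable_fun_sum _ fun p _ => ?_)
  simp only [Int.cast_ite]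
  exact Measurable.ite measurableSet_Ioi measurable_const measurable_const

lemma memLp_stepFun (a : ℤ) (P : Finset ℝ) (J : ℝ → ℤ) :
    MemLp (fun t => (stepFun a P J t : ℝ)) 1 unitMeasure := by
  refine MemLp.of_bound (measurable_stepFun a P J).aestronglyMeasurable
    ((|a| + ∑ p ∈ P, |J p| : ℤ) : ℝ) (Eventually.of_forall fun t => ?_)
  rw [Real.norm_eq_abs, ← Int.cast_abs, Int.cast_le]
  refine (abs_add_le _ _).trans (add_le_add_right ?_ _)
  refine (Finset.abs_sum_le_sum_abs _ _).trans ?_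
  exact Finset.sum_le_sum_of_subset_of_nonneg (Finset.filter_subset _ _)
    fun p _ _ => abs_nonneg _

lemma exists_isStep (a : ℤ) (P : Finset ℝ) (J : ℝ → ℤ) : ∃ w, IsStep a P J w :=
  ⟨(memLp_stepFun a P J).toLp _, (memLp_stepFun a P J).coeFn_toLp⟩

lemma integrable_stepFun (a : ℤ) (P : Finset ℝ) (J : ℝ → ℤ) :
    Integrable (fun t => (stepFun a P J t : ℝ)) unitMeasure :=
  memLp_one_iff_integrable.1 (memLp_stepFun a P J)

lemma eventually_left_stepFun_eq (a : ℤ) (P : Finset ℝ) (J : ℝ → ℤ) (t : ℝ) :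
    ∀ᶠ s in 𝓝[<] t, stepFun a P J s = stepFun a P J t := by
  have h : ∀ᶠ s in 𝓝[<] t, ∀ p ∈ P, p < s ↔ p < t := by
    refine (Finset.eventually_all P).2 fun p _ => ?_
    by_cases hp : p < t
    · filter_upwards [nhdsWithin_le_nhds (Ioi_mem_nhds hp)] with s hs
      exact ⟨fun _ => hp, fun _ => hs⟩
    · filter_upwards [self_mem_nhdsWithin] with s hs
      exact ⟨fun h => h.trans hs, fun h => absurd h hp⟩
  exact h.mono fun s hs => stepFun_congr hs

lemma eventually_right_stepFun_eq (a : ℤ) (P : Finset ℝ) (J : ℝ → ℤ) (t : ℝ) :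
    ∀ᶠ s in 𝓝[>] t, stepFun a P J s = stepFun a P J t + if t ∈ P then J t else 0 := by
  have h : ∀ᶠ s in 𝓝[>] t, ∀ p ∈ P, p < s ↔ p ≤ t := by
    refine (Finset.eventually_all P).2 fun p _ => ?_
    by_cases hp : p ≤ t
    · filter_upwards [self_mem_nhdsWithin] with s hs
      exact ⟨fun _ => hp, fun _ => hp.trans_lt hs⟩
    · filter_upwards [nhdsWithin_le_nhds (Iio_mem_nhds (not_le.1 hp))] with s hs
      exact ⟨fun h => absurd h (not_lt.2 (le_of_lt hs)), fun h => absurd h hp⟩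
  filter_upwards [h, self_mem_nhdsWithin] with s hs hts
  rw [← sub_eq_iff_eq_add', stepFun_sub (le_of_lt hts), Finset.filter_congr (q := fun p => p = t)
    fun p hp => by rw [hs p hp]; exact ⟨fun h => le_antisymm h.2 h.1, fun h => ⟨h.ge, h.le⟩⟩]
  by_cases ht : t ∈ P
  · rw [if_pos ht, Finset.filter_eq' P t, if_pos ht, Finset.sum_singleton]
  · rw [if_neg ht, Finset.filter_eq' P t, if_neg ht, Finset.sum_empty]

end StepFun

/-! ### One-sided limits and total variation of a step function in `L1`. -/

lemma exists_mem_Ioo_of_ae {p : ℝ → Prop} (h : ∀ᵐ t ∂unitMeasure, p t) {c d : ℝ} (hcd : c < d)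
    (hc : 0 ≤ c) (hd : d ≤ 1) : ∃ t ∈ Ioo c d, p t := by
  by_contra hcon
  push Not at hcon
  have h0 := ae_unitMeasure_iff.1 h
  have : volume (Ioo c d) = 0 := by
    refine measure_mono_null (fun t ht => ?_) (ae_iff.1 h0)
    exact fun h' => hcon t ht (h' ⟨hc.trans_lt ht.1, ht.2.trans_le hd⟩)
  rw [Real.volume_Ioo, ENNReal.ofReal_eq_zero] at this
  linarith

/-- Limits along this filter are unique only if it is nontrivial; this is what lets `limUnder` in
`leftLim` be evaluated. -/
lemma neBot_ae_inf_left {t : ℝ} (ht : t ∈ Ioo (0 : ℝ) 1) : (ae unitMeasure ⊓ 𝓝[<] t).NeBot := by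
  rw [inf_neBot_iff]
  intro s hs u hu
  obtain ⟨c, hc, hcu⟩ := (mem_nhdsLT_iff_exists_Ioo_subset' ht.1).1 hu
  obtain ⟨r, hr, hr'⟩ := exists_mem_Ioo_of_ae hs (max_lt hc ht.1 : max c 0 < t)
    (le_max_right _ _) ht.2.le
  exact ⟨r, hr', hcu ⟨(le_max_left _ _).trans_lt hr.1, hr.2⟩⟩

lemma neBot_ae_inf_right {t : ℝ} (ht : t ∈ Ioo (0 : ℝ) 1) :
    (ae unitMeasure ⊓ 𝓝[>] t).NeBot := by
  rw [inf_neBot_iff]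
  intro s hs u hu
  obtain ⟨c, hc, hcu⟩ := (mem_nhdsGT_iff_exists_Ioo_subset' ht.2).1 hu
  obtain ⟨r, hr, hr'⟩ := exists_mem_Ioo_of_ae hs (lt_min hc ht.2 : t < min c 1) ht.1.le
    (min_le_right _ _)
  exact ⟨r, hr', hcu ⟨hr.1, hr.2.trans_le (min_le_left _ _)⟩⟩

namespace IsStep

variable {a : ℤ} {P : Finset ℝ} {J : ℝ → ℤ} {w : L1} {t : ℝ}

lemma leftLim_eq (hw : IsStep a P J w) (ht : t ∈ Ioo (0 : ℝ) 1) :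
    leftLim w t = stepFun a P J t := by
  have := neBot_ae_inf_left ht
  refine Tendsto.limUnder_eq (tendsto_const_nhds.congr' ?_)
  filter_upwards [mem_inf_of_left hw, mem_inf_of_right (eventually_left_stepFun_eq a P J t)]
    with s h1 h2
  rw [h1, h2]

lemma rightLim_eq (hw : IsStep a P J w) (ht : t ∈ Ioo (0 : ℝ) 1) :
    rightLim w t = (stepFun a P J t + if t ∈ P then J t else 0 : ℤ) := by
  have := neBot_ae_inf_right ht
  refine Tendsto.limUnder_eq (tendsto_const_nhds.congr' ?_)
  filter_upwards [mem_inf_of_left hw, mem_inf_of_right (eventually_right_stepFun_eq a P J t)]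
    with s h1 h2
  rw [h1, h2]

lemma switches_eq (hw : IsStep a P J w) :
    switches w = {t | t ∈ Ioo (0 : ℝ) 1 ∧ t ∈ P ∧ J t ≠ 0} := by
  ext t
  refine and_congr_right fun ht => ?_
  rw [hw.leftLim_eq ht, hw.rightLim_eq ht]
  by_cases h : t ∈ P
  · simp [h]
  · simp [h]

/-- By left continuity the value at `t` is also taken on an interval to the left of `t`, which a
null set cannot cover. An almost everywhere statement thus becomes a pointwise one. -/
lemma mem_of_ae_mem {W : Finset ℤ} (hw : IsStep a P J w)
    (hW : ∀ᵐ t ∂unitMeasure, ∃ k ∈ W, w t = (k : ℝ)) (ht : t ∈ Ioo (0 : ℝ) 1) :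
    stepFun a P J t ∈ W := by
  have := neBot_ae_inf_left ht
  have h : ∀ᶠ s in ae unitMeasure ⊓ 𝓝[<] t, stepFun a P J t ∈ W := by
    filter_upwards [mem_inf_of_left hw, mem_inf_of_left hW,
      mem_inf_of_right (eventually_left_stepFun_eq a P J t)] with s h1 h2 h3
    obtain ⟨k, hk, hk'⟩ := h2
    rw [h1, h3, Int.cast_inj] at hk'
    rwa [hk']
  exact h.exists.choose_spec

end IsStep

/-- Increments are dominated by those of the monotone function `stepVar`, whose sum telescopes. -/
lemma eVariationOn_stepFun_le (a : ℤ) (P : Finset ℝ) (J : ℝ → ℤ) (S : Set ℝ) :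
    eVariationOn (fun t => (stepFun a P J t : ℝ)) S ≤
      ENNReal.ofReal ((∑ p ∈ P, |J p| : ℤ) : ℝ) := by
  refine iSup_le fun ⟨n, u, hu, _⟩ => ?_
  have h : ∀ i, edist (stepFun a P J (u (i + 1)) : ℝ) (stepFun a P J (u i) : ℝ) ≤
      ENNReal.ofReal ((stepVar P J (u (i + 1)) : ℝ) - stepVar P J (u i)) := by
    intro i
    rw [edist_dist, Real.dist_eq]
    refine ENNReal.ofReal_le_ofReal ?_
    exact_mod_cast abs_stepFun_sub_le (hu i.le_succ)
  refine (Finset.sum_le_sum fun i _ => h i).trans ?_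
  rw [← ENNReal.ofReal_sum_of_nonneg fun i _ => ?_]
  · rw [Finset.sum_range_sub (fun i => (stepVar P J (u i) : ℝ))]
    refine ENNReal.ofReal_le_ofReal ?_
    exact_mod_cast (sub_le_self _ (stepVar_nonneg P J (u 0))).trans (stepVar_le P J (u n))
  · rw [sub_nonneg]
    exact_mod_cast stepVar_mono P J (hu i.le_succ)

/-- An arbitrary representative agrees with the step function only on a set `G` of full measure, so
the variation has to be detected by points of `G`. Induction on the largest jump point: two points
of `G` around it see that jump, and all other jumps are seen to the left of this pair. The right end
`b` varies in the induction. -/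
lemma le_eVariationOn_stepFun {G : Set ℝ} (hG : ∀ᵐ t ∂unitMeasure, t ∈ G) (a : ℤ) (J : ℝ → ℤ)
    (P : Finset ℝ) : (∀ p ∈ P, 0 < p) → ∀ b : ℝ, (∀ p ∈ P, p < b) → b ≤ 1 →
      ENNReal.ofReal ((∑ p ∈ P, |J p| : ℤ) : ℝ) ≤
        eVariationOn (fun t => (stepFun a P J t : ℝ)) (G ∩ Ioo 0 b) := by
  induction P using Finset.induction_on_max with
  | empty => intro _ b _ _; simp
  | insert q P hq ih =>
    intro h0 b hb hb1
    have hqP : q ∉ P := fun h => lt_irrefl q (hq q h)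
    have hq0 : 0 < q := h0 q (Finset.mem_insert_self _ _)
    have hqb : q < b := hb q (Finset.mem_insert_self _ _)
    obtain ⟨c, hcq, hc0, hc⟩ : ∃ c < q, 0 ≤ c ∧ ∀ p ∈ P, p ≤ c := by
      rcases P.eq_empty_or_nonempty with rfl | hne
      · exact ⟨0, hq0, le_rfl, by simp⟩
      · exact ⟨P.max' hne, hq _ (P.max'_mem hne),
          (h0 _ (Finset.mem_insert_of_mem (P.max'_mem hne))).le, fun p hp => P.le_max' p hp⟩
    obtain ⟨s, hs, hsG⟩ := exists_mem_Ioo_of_ae hG hcq hc0 (hqb.le.trans hb1)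
    obtain ⟨t, ht, htG⟩ := exists_mem_Ioo_of_ae hG hqb hq0.le hb1
    have heq : ∀ r ≤ q, stepFun a (insert q P) J r = stepFun a P J r := by
      intro r hr
      rw [stepFun, stepFun, Finset.filter_insert, if_neg (not_lt.2 hr)]
    have h1 := ih (fun p hp => h0 p (Finset.mem_insert_of_mem hp)) s
      (fun p hp => (hc p hp).trans_lt hs.1) (hs.2.le.trans (hqb.le.trans hb1))
    have h2 : eVariationOn (fun t => (stepFun a P J t : ℝ)) (G ∩ Ioo 0 s) =
        eVariationOn (fun t => (stepFun a (insert q P) J t : ℝ)) (G ∩ Ioo 0 s) :=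
      eVariationOn.congr fun r hr => by simp only [heq r (hr.2.2.le.trans hs.2.le)]
    have h3 : stepFun a (insert q P) J t - stepFun a (insert q P) J s = J q := by
      rw [stepFun_sub (hs.2.trans ht.1).le, Finset.filter_congr (q := fun p => p = q),
        Finset.filter_eq', if_pos (Finset.mem_insert_self _ _), Finset.sum_singleton]
      intro p hp
      rcases Finset.mem_insert.1 hp with rfl | hp
      · simp [hs.2.le, ht.1]
      · have := (hc p hp).trans_lt hs.1
        exact ⟨fun h => absurd h.1 (not_le.2 this), fun h => absurd (h ▸ hp) hqP⟩
    have h4 : ENNReal.ofReal ((|J q| : ℤ) : ℝ) ≤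
        eVariationOn (fun t => (stepFun a (insert q P) J t : ℝ)) {s, t} := by
      rw [eVariationOn.pair, edist_comm, edist_dist, Real.dist_eq]
      refine ENNReal.ofReal_le_ofReal ?_
      rw [← Int.cast_sub, h3, Int.cast_abs]
    calc ENNReal.ofReal ((∑ p ∈ insert q P, |J p| : ℤ) : ℝ)
        = ENNReal.ofReal ((∑ p ∈ P, |J p| : ℤ) : ℝ) + ENNReal.ofReal ((|J q| : ℤ) : ℝ) := by
          rw [Finset.sum_insert hqP, add_comm, Int.cast_add, ENNReal.ofReal_add]
          · exact_mod_cast Finset.sum_nonneg fun p _ => abs_nonneg _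
          · exact_mod_cast abs_nonneg _
      _ ≤ _ := add_le_add (h1.trans_eq h2) h4
      _ ≤ _ := eVariationOn.add_le_union _ (by
          intro x hx y hy
          rcases hy with rfl | rfl
          · exact hx.2.2.le
          · exact hx.2.2.le.trans (hs.2.trans ht.1).le)
      _ ≤ _ := eVariationOn.mono _ (by
          rintro x (hx | rfl | rfl)
          · exact ⟨hx.1, hx.2.1, hx.2.2.trans (hs.2.trans hqb)⟩
          · exact ⟨hsG, hc0.trans_lt hs.1, hs.2.trans hqb⟩
          · exact ⟨htG, hq0.trans ht.1, ht.2⟩)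

namespace IsStep

variable {a : ℤ} {P : Finset ℝ} {J : ℝ → ℤ} {w : L1}

lemma totalVariation_le (hw : IsStep a P J w) :
    totalVariation w ≤ ENNReal.ofReal ((∑ p ∈ P, |J p| : ℤ) : ℝ) :=
  (iInf₂_le (f := fun (f : ℝ → ℝ) (_ : f =ᵐ[unitMeasure] w) => eVariationOn f (Ioo 0 1)) _
    hw.symm).trans (eVariationOn_stepFun_le a P J _)

lemma toReal_totalVariation_le (hw : IsStep a P J w) :
    (totalVariation w).toReal ≤ ((∑ p ∈ P, |J p| : ℤ) : ℝ) :=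
  ENNReal.toReal_le_of_le_ofReal
    (by exact_mod_cast Finset.sum_nonneg fun p _ => abs_nonneg _) hw.totalVariation_le

lemma toReal_totalVariation (hw : IsStep a P J w) (hP : ∀ p ∈ P, p ∈ Ioo (0 : ℝ) 1) :
    (totalVariation w).toReal = ((∑ p ∈ P, |J p| : ℤ) : ℝ) := by
  have h : totalVariation w = ENNReal.ofReal ((∑ p ∈ P, |J p| : ℤ) : ℝ) := by
    refine le_antisymm hw.totalVariation_le (le_iInf₂ fun f hf => ?_)
    have hG : ∀ᵐ t ∂unitMeasure, t ∈ {t | f t = (stepFun a P J t : ℝ)} := hf.trans hw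
    refine (le_eVariationOn_stepFun hG a J P (fun p hp => (hP p hp).1) 1
      (fun p hp => (hP p hp).2) le_rfl).trans ?_
    rw [← eVariationOn.congr (f := f) fun t ht => ht.1]
    exact eVariationOn.mono _ inter_subset_right
  rw [h, ENNReal.toReal_ofReal]
  exact_mod_cast Finset.sum_nonneg fun p _ => abs_nonneg _

lemma mem_switchSpace {W : Finset ℤ} {n : ℕ} (hw : IsStep a P J w) (hn : P.card ≤ n)
    (hW : ∀ t ∈ Ioo (0 : ℝ) 1, stepFun a P J t ∈ W) : w ∈ switchSpace W n := by
  refine ⟨⟨hw.totalVariation_le.trans_lt ENNReal.ofReal_lt_top, ?_⟩, ?_⟩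
  · filter_upwards [hw, ae_restrict_mem measurableSet_Ioo] with t h1 h2
    exact ⟨_, hW t h2, h1⟩
  · calc (switches w).encard ≤ (P : Set ℝ).encard :=
        encard_le_encard (by rw [hw.switches_eq]; exact fun t ht => ht.2.1)
      _ = P.card := encard_coe_eq_coe_finsetCard P
      _ ≤ n := by exact_mod_cast hn

end IsStep

/-! ### Functions in `BVW` as normalized step functions. -/

/-- The positions `τ k` may coincide or leave `(0, 1)`. Jumps at the same point are added, those at
positions `≤ 0` go into the constant, those at positions `≥ 1` are invisible, and vanishing sums are
dropped; none of this increases the number of jumps or their total size. -/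
lemma exists_stepFun_eq_sum {ι : Type*} (a : ℤ) (S : Finset ι) (τ : ι → ℝ) (j : ι → ℤ) :
    ∃ (b : ℤ) (P : Finset ℝ) (J : ℝ → ℤ), (∀ p ∈ P, p ∈ Ioo (0 : ℝ) 1) ∧ (∀ p ∈ P, J p ≠ 0) ∧
      P.card ≤ S.card ∧ ∑ p ∈ P, |J p| ≤ ∑ k ∈ S, |j k| ∧
      ∀ t ∈ Ioo (0 : ℝ) 1, stepFun b P J t = a + ∑ k ∈ S with τ k < t, j k := by
  classical
  set J : ℝ → ℤ := fun p => ∑ k ∈ S with τ k = p, j k with hJ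
  refine ⟨a + ∑ k ∈ S with τ k ≤ 0, j k,
    (S.image τ).filter fun p => p ∈ Ioo (0 : ℝ) 1 ∧ J p ≠ 0, J,
    fun p hp => (Finset.mem_filter.1 hp).2.1, fun p hp => (Finset.mem_filter.1 hp).2.2,
    (Finset.card_filter_le _ _).trans Finset.card_image_le, ?_, fun t ht => ?_⟩
  · refine (Finset.sum_le_sum_of_subset_of_nonneg (Finset.filter_subset _ _)
      fun p _ _ => abs_nonneg _).trans ?_
    rw [← Finset.sum_fiberwise_of_maps_to (g := τ) (t := S.image τ)
      fun k hk => Finset.mem_image_of_mem _ hk]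
    exact Finset.sum_le_sum fun p _ => Finset.abs_sum_le_sum_abs _ _
  have h1 : ∑ k ∈ S with (0 < τ k ∧ τ k < t), j k =
      ∑ p ∈ (S.image τ).filter (fun p => 0 < p ∧ p < t), J p := by
    rw [← Finset.sum_fiberwise_of_maps_to (g := τ)
      (t := (S.image τ).filter (fun p => 0 < p ∧ p < t))]
    · refine Finset.sum_congr rfl fun p hp => ?_
      rw [hJ]
      refine Finset.sum_congr ?_ fun _ _ => rfl
      ext k
      simp only [Finset.mem_filter] at hp ⊢
      constructor
      · rintro ⟨⟨h1, _⟩, h2⟩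
        exact ⟨h1, h2⟩
      · rintro ⟨h1, rfl⟩
        exact ⟨⟨h1, hp.2⟩, rfl⟩
    · intro k hk
      simp only [Finset.mem_filter] at hk ⊢
      exact ⟨Finset.mem_image_of_mem _ hk.1, hk.2⟩
  have h2 : ∑ p ∈ (S.image τ).filter (fun p => 0 < p ∧ p < t), J p =
      ∑ p ∈ (S.image τ).filter (fun p => p ∈ Ioo (0 : ℝ) 1 ∧ J p ≠ 0) with p < t,
        J p := by
    refine (Finset.sum_subset (fun p hp => ?_) fun p hp hp' => ?_).symm
    · simp only [Finset.mem_filter, mem_Ioo] at hp ⊢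
      exact ⟨hp.1.1, hp.1.2.1.1, hp.2⟩
    · simp only [Finset.mem_filter, mem_Ioo] at hp hp'
      by_contra h0
      exact hp' ⟨⟨hp.1, ⟨hp.2.1, hp.2.2.trans ht.2⟩, h0⟩, hp.2.2⟩
  rw [stepFun, ← h2, ← h1, add_assoc]
  congr 1
  simp only [Finset.sum_filter, ← Finset.sum_add_distrib]
  refine Finset.sum_congr rfl fun k _ => ?_
  by_cases h0 : τ k ≤ 0
  · simp [h0, h0.trans_lt ht.1, not_lt.2 h0]
  · simp [h0, not_le.1 h0]

/-- Let `v t` be the integer part of the variation of a representative up to `t`, measured on the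
points with integer values. Two different integers are at distance at least 1, so the representative
is constant where `v` is. It is therefore a function of `v`, which is monotone and takes finitely
many values. -/
lemma exists_isStep_of_mem_BVW {W : Finset ℤ} {w : L1} (hw : w ∈ BVW W) :
    ∃ (a : ℤ) (P : Finset ℝ) (J : ℝ → ℤ), IsStep a P J w ∧ (∀ p ∈ P, p ∈ Ioo (0 : ℝ) 1) ∧
      ∀ p ∈ P, J p ≠ 0 := by
  classical
  obtain ⟨hTV, hW⟩ := hw
  obtain ⟨f, hf, hfV⟩ : ∃ f : ℝ → ℝ, f =ᵐ[unitMeasure] w ∧ eVariationOn f (Ioo 0 1) < ∞ := by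
    simpa only [totalVariation, iInf_lt_iff, exists_prop] using hTV
  set G : Set ℝ := {t | t ∈ Ioo (0 : ℝ) 1 ∧ ∃ k : ℤ, f t = k} with hG
  have hGae : ∀ᵐ t ∂unitMeasure, t ∈ G := by
    filter_upwards [hf, hW, ae_restrict_mem measurableSet_Ioo] with t h1 h2 h3
    obtain ⟨k, _, hk⟩ := h2
    exact ⟨h3, k, h1.trans hk⟩
  have hfin : ∀ t, eVariationOn f (G ∩ Iic t) ≠ ∞ := fun t =>
    ((eVariationOn.mono f fun s hs => hs.1.1).trans_lt hfV).ne
  set v : ℝ → ℕ := fun t => ⌊(eVariationOn f (G ∩ Iic t)).toReal⌋₊ with hv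
  have hvm : Monotone v := fun s t hst => Nat.floor_mono (ENNReal.toReal_mono (hfin t)
    (eVariationOn.mono f (inter_subset_inter_right _ (Iic_subset_Iic.2 hst))))
  set N : ℕ := ⌊(eVariationOn f (Ioo 0 1)).toReal⌋₊ with hN
  have hvN : ∀ t, v t ≤ N := fun t => Nat.floor_mono (ENNReal.toReal_mono hfV.ne
    (eVariationOn.mono f fun s hs => hs.1.1))
  have hconst' : ∀ s ∈ G, ∀ t ∈ G, s ≤ t → v s = v t → f s = f t := by
    intro s hs t ht hst hvst
    have h1 : eVariationOn f (G ∩ Iic s) + edist (f s) (f t) ≤ eVariationOn f (G ∩ Iic t) := by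
      rw [← eVariationOn.pair]
      refine (eVariationOn.add_le_union f ?_).trans (eVariationOn.mono f ?_)
      · rintro x hx y (rfl | rfl)
        · exact hx.2
        · exact (le_trans hx.2 hst : x ≤ _)
      · rintro x (hx | rfl | rfl)
        · exact ⟨hx.1, le_trans hx.2 hst⟩
        · exact ⟨hs, hst⟩
        · exact ⟨ht, mem_Iic.2 le_rfl⟩
    have h2 : (eVariationOn f (G ∩ Iic s)).toReal + |f s - f t| ≤
        (eVariationOn f (G ∩ Iic t)).toReal := by
      have h3 := ENNReal.toReal_mono (hfin t) h1
      rwa [ENNReal.toReal_add (hfin s) (edist_ne_top _ _), edist_dist,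
        ENNReal.toReal_ofReal dist_nonneg, Real.dist_eq] at h3
    have h4 : (eVariationOn f (G ∩ Iic t)).toReal < v s + 1 := by
      rw [hvst]; exact Nat.lt_floor_add_one _
    have h5 : (v s : ℝ) ≤ (eVariationOn f (G ∩ Iic s)).toReal := Nat.floor_le ENNReal.toReal_nonneg
    obtain ⟨k, hk⟩ := hs.2
    obtain ⟨l, hl⟩ := ht.2
    rw [hk, hl] at h2 ⊢
    have h6 : |k - l| < 1 := by
      have : |(k : ℝ) - l| < 1 := by linarith
      exact_mod_cast this
    rw [Int.abs_lt_one_iff, sub_eq_zero] at h6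
    rw [h6]
  have hconst : ∀ s ∈ G, ∀ t ∈ G, v s = v t → f s = f t := by
    intro s hs t ht hst
    rcases le_total s t with h | h
    · exact hconst' s hs t ht h hst
    · exact (hconst' t ht s hs h hst.symm).symm
  obtain ⟨c, hc⟩ : ∃ c : ℕ → ℤ, ∀ t ∈ G, f t = c (v t) := by
    have : ∀ k : ℕ, ∃ l : ℤ, ∀ t ∈ G, v t = k → f t = l := by
      intro k
      by_cases h : ∃ s ∈ G, v s = k
      · obtain ⟨s, hs, hsk⟩ := h
        obtain ⟨l, hl⟩ := hs.2
        exact ⟨l, fun t ht htk => (hconst t ht s hs (htk.trans hsk.symm)).trans hl⟩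
      · exact ⟨0, fun t ht htk => absurd ⟨t, ht, htk⟩ h⟩
    choose c hc using this
    exact ⟨c, fun t ht => hc _ t ht rfl⟩
  -- The extra point 1 makes the set nonempty and puts the switch outside `(0, 1)` if the level `k`
  -- is never exceeded.
  set S : ℕ → Set ℝ := fun k => insert 1 {t | t ∈ G ∧ k < v t} with hS
  have hSb : ∀ k, BddBelow (S k) := by
    refine fun k => ⟨0, ?_⟩
    rintro t (rfl | ht)
    · exact zero_le_one
    · exact ht.1.1.1.le
  obtain ⟨b, P, J, hP, hJ, -, -, hval⟩ :=
    exists_stepFun_eq_sum (c 0) (Finset.range N) (fun k => sInf (S k)) fun k => c (k + 1) - c k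
  refine ⟨b, P, J, ?_, hP, hJ⟩
  -- At the infimum itself `v` may or may not have passed the level; these countably many points are
  -- discarded.
  have hne : ∀ᵐ t ∂unitMeasure, ∀ k : ℕ, t ≠ sInf (S k) :=
    ae_all_iff.2 fun k => ae_restrict_of_ae (Measure.ae_ne volume _)
  filter_upwards [hf, hGae, hne] with t h1 h2 h3
  rw [← h1, hc t h2, hval t h2.1, Int.cast_inj]
  have h4 : ∀ k, sInf (S k) < t ↔ k < v t := by
    intro k
    constructor
    · intro h
      obtain ⟨s, hs, hst⟩ := exists_lt_of_csInf_lt (insert_nonempty _ _) h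
      rcases hs with rfl | hs
      · exact absurd hst (not_lt.2 h2.1.2.le)
      · exact hs.2.trans_le (hvm hst.le)
    · exact fun h => lt_of_le_of_ne (csInf_le (hSb k) (mem_insert_of_mem _ ⟨h2, h⟩)) (h3 k).symm
  have h5 : (Finset.range N).filter (fun k => sInf (S k) < t) = Finset.range (v t) := by
    ext k
    simp only [Finset.mem_filter, Finset.mem_range, h4]
    exact ⟨fun h => h.2, fun h => ⟨h.trans_le (hvN t), h⟩⟩
  rw [h5, Finset.sum_range_sub]
  ring

/-- The data of a normalized step representation of an element of `switchSpace W n`. -/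
structure IsSwitchRep (W : Finset ℤ) (n : ℕ) (a : ℤ) (P : Finset ℝ) (J : ℝ → ℤ) (w : L1) :
    Prop where
  isStep : IsStep a P J w
  mem_Ioo : ∀ p ∈ P, p ∈ Ioo (0 : ℝ) 1
  ne_zero : ∀ p ∈ P, J p ≠ 0
  card_le : P.card ≤ n
  mem : ∀ t ∈ Ioo (0 : ℝ) 1, stepFun a P J t ∈ W

lemma exists_isSwitchRep {W : Finset ℤ} {n : ℕ} {w : L1} (hw : w ∈ switchSpace W n) :
    ∃ a P J, IsSwitchRep W n a P J w := by
  obtain ⟨a, P, J, h, hP, hJ⟩ := exists_isStep_of_mem_BVW hw.1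
  refine ⟨a, P, J, h, hP, hJ, ?_, fun t ht => h.mem_of_ae_mem hw.1.2 ht⟩
  have h1 : switches w = (P : Set ℝ) := by
    rw [h.switches_eq]
    ext p
    exact ⟨fun hp => hp.2.1, fun hp => ⟨hP p hp, hp, hJ p hp⟩⟩
  have h2 := hw.2
  rw [h1, encard_coe_eq_coe_finsetCard] at h2
  exact_mod_cast h2

namespace IsSwitchRep

variable {W : Finset ℤ} {n : ℕ} {a : ℤ} {P : Finset ℝ} {J : ℝ → ℤ} {w : L1}

lemma switches_eq (h : IsSwitchRep W n a P J w) : switches w = (P : Set ℝ) := by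
  rw [h.isStep.switches_eq]
  ext p
  exact ⟨fun hp => hp.2.1, fun hp => ⟨h.mem_Ioo p hp, hp, h.ne_zero p hp⟩⟩

lemma criticality_eq (h : IsSwitchRep W n a P J w) (gradF : L1 → LInf) :
    criticality gradF w = ∑ p ∈ P, |contRep (gradF w) p| * |(J p : ℝ)| := by
  rw [criticality, h.switches_eq]
  simp only [Finset.mem_coe]
  rw [finsum_mem_finset_eq_sum]
  refine Finset.sum_congr rfl fun p hp => ?_
  rw [h.isStep.leftLim_eq (h.mem_Ioo p hp), h.isStep.rightLim_eq (h.mem_Ioo p hp), if_pos hp,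
    Int.cast_add, add_sub_cancel_left, abs_mul]

lemma totalVariation_eq (h : IsSwitchRep W n a P J w) :
    (totalVariation w).toReal = ((∑ p ∈ P, |J p| : ℤ) : ℝ) :=
  h.isStep.toReal_totalVariation h.mem_Ioo

/-- The value of the step function just to the right of a point is attained. -/
lemma add_mem (h : IsSwitchRep W n a P J w) {p : ℝ} (hp : p ∈ P) : stepFun a P J p + J p ∈ W := by
  have h1 := eventually_right_stepFun_eq a P J p
  have h2 : ∀ᶠ t in 𝓝[>] p, t ∈ Ioo (0 : ℝ) 1 :=
    nhdsWithin_le_nhds (isOpen_Ioo.mem_nhds (h.mem_Ioo p hp))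
  obtain ⟨t, h3, h4⟩ := (h1.and h2).exists
  rw [if_pos hp] at h3
  rw [← h3]
  exact h.mem t h4

lemma abs_jump_le (h : IsSwitchRep W n a P J w) {D : ℤ} (hD : ∀ k ∈ W, ∀ l ∈ W, |k - l| ≤ D)
    {p : ℝ} (hp : p ∈ P) : |J p| ≤ D := by
  have := hD _ (h.add_mem hp) _ (h.mem p (h.mem_Ioo p hp))
  rwa [add_sub_cancel_left] at this

lemma sum_abs_jump_le (h : IsSwitchRep W n a P J w) {D : ℤ} (hD0 : 0 ≤ D)
    (hD : ∀ k ∈ W, ∀ l ∈ W, |k - l| ≤ D) : ∑ p ∈ P, |J p| ≤ n * D := by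
  refine (Finset.sum_le_card_nsmul _ _ D fun p hp => h.abs_jump_le hD hp).trans ?_
  rw [nsmul_eq_mul]
  exact mul_le_mul_of_nonneg_right (by exact_mod_cast h.card_le) hD0

end IsSwitchRep

/-! ### Moving jumps -/

/-- The indicator function of `(p, ∞)`. -/
def heaviside (p t : ℝ) : ℝ := if p < t then 1 else 0

lemma stepFun_cast (a : ℤ) (P : Finset ℝ) (J : ℝ → ℤ) (t : ℝ) :
    (stepFun a P J t : ℝ) = a + ∑ p ∈ P, (J p : ℝ) * heaviside p t := by
  rw [stepFun_eq_sum_ite, Int.cast_add, Int.cast_sum]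
  congr 1
  refine Finset.sum_congr rfl fun p _ => ?_
  simp only [heaviside]
  split_ifs <;> simp

lemma measurable_heaviside (p : ℝ) : Measurable (heaviside p) :=
  Measurable.ite measurableSet_Ioi measurable_const measurable_const

lemma abs_heaviside_le (p t : ℝ) : |heaviside p t| ≤ 1 := by
  simp only [heaviside]
  split_ifs <;> simp

lemma integrable_mul_heaviside {G : ℝ → ℝ} (hG : Integrable G unitMeasure) (p : ℝ) :
    Integrable (fun t => G t * heaviside p t) unitMeasure :=
  hG.mul_bdd (c := 1) (measurable_heaviside p).aestronglyMeasurable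
    (Eventually.of_forall fun t => abs_heaviside_le p t)

lemma integrable_of_continuous {G : ℝ → ℝ} (hG : Continuous G) :
    Integrable G unitMeasure :=
  (hG.locallyIntegrable.integrableOn_isCompact isCompact_Icc).mono_set Ioo_subset_Icc_self

lemma integral_mul_heaviside (G : ℝ → ℝ) {p : ℝ} (hp : p ∈ Icc (0 : ℝ) 1) :
    ∫ t, G t * heaviside p t ∂unitMeasure = ∫ t in p..1, G t := by
  have h : ∀ t, G t * heaviside p t = (Ioi p).indicator G t := by
    intro t
    simp only [heaviside, indicator_apply, mem_Ioi]
    split_ifs <;> simp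
  simp_rw [h]
  rw [setIntegral_indicator measurableSet_Ioi, intervalIntegral.integral_of_le hp.2,
    integral_Ioc_eq_integral_Ioo]
  congr 2
  ext t
  simp only [mem_inter_iff, mem_Ioo, mem_Ioi]
  exact ⟨fun h => ⟨h.2, h.1.2⟩, fun h => ⟨⟨hp.1.trans_lt h.1, h.2⟩, h.1⟩⟩

lemma integral_abs_heaviside_sub_le (p q : ℝ) :
    ∫ t, |heaviside q t - heaviside p t| ∂unitMeasure ≤ |q - p| := by
  have h : ∀ t, |heaviside q t - heaviside p t| = (uIoc p q).indicator 1 t := by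
    intro t
    simp only [heaviside]
    rcases lt_or_ge p t with h1 | h1 <;> rcases lt_or_ge q t with h2 | h2
    · rw [indicator_of_notMem]
      · simp [h1, h2]
      · rw [mem_uIoc]
        rintro (h | h) <;> linarith [h.2]
    · rw [indicator_of_mem (mem_uIoc.2 (Or.inl ⟨h1, h2⟩))]
      simp [h1, not_lt.2 h2]
    · rw [indicator_of_mem (mem_uIoc.2 (Or.inr ⟨h2, h1⟩))]
      simp [h2, not_lt.2 h1]
    · rw [indicator_of_notMem]
      · simp [not_lt.2 h1, not_lt.2 h2]
      · rw [mem_uIoc]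
        rintro (h | h) <;> linarith [h.1]
  simp_rw [h]
  rw [integral_indicator_one measurableSet_uIoc]
  calc unitMeasure.real (uIoc p q) ≤ volume.real (uIoc p q) :=
        ENNReal.toReal_mono (by simp [uIoc]) (Measure.restrict_le_self _)
    _ = |q - p| := by
        rw [Measure.real, uIoc, Real.volume_Ioc, max_sub_min_eq_abs,
          ENNReal.toReal_ofReal (abs_nonneg _)]

/-- Moving a jump of height `c` from `p` by the clamped value `τ` changes the integral against a
Lipschitz function as predicted by the value at `p`, up to a quadratic error. -/
lemma mul_integral_le_of_lipschitz {G : ℝ → ℝ} {M : ℝ} (hM : 0 ≤ M)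
    (hG : LipschitzWith M.toNNReal G) (c p τ : ℝ) :
    c * ∫ t in (p + τ)..p, G t ≤ -(c * τ * G p) + |c| * (M * τ ^ 2) := by
  have h1 : ∫ t in (p + τ)..p, (G t - G p) = (∫ t in (p + τ)..p, G t) + τ * G p := by
    rw [intervalIntegral.integral_sub (hG.continuous.intervalIntegrable _ _)
      intervalIntegrable_const, intervalIntegral.integral_const, smul_eq_mul]
    ring
  have h2 : ‖∫ t in (p + τ)..p, (G t - G p)‖ ≤ (M * |τ|) * |p - (p + τ)| := by
    refine intervalIntegral.norm_integral_le_of_norm_le_const fun t ht => ?_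
    have h3 := hG.dist_le_mul t p
    rw [Real.coe_toNNReal _ hM, Real.dist_eq, Real.dist_eq] at h3
    refine h3.trans (mul_le_mul_of_nonneg_left ?_ hM)
    have h4 := abs_sub_right_of_mem_uIcc (uIoc_subset_uIcc ht)
    rwa [abs_sub_comm, show p - (p + τ) = -τ by ring, abs_neg] at h4
  rw [Real.norm_eq_abs, show p - (p + τ) = -τ by ring, abs_neg, mul_assoc, ← sq, sq_abs] at h2
  have h5 : c * ∫ t in (p + τ)..p, (G t - G p) ≤ |c| * (M * τ ^ 2) :=
    (le_abs_self _).trans (by rw [abs_mul]; exact mul_le_mul_of_nonneg_left h2 (abs_nonneg _))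
  rw [h1] at h5
  linarith

/-- The displacement of a jump of sign `s` where the gradient has the value `g`. -/
def shift (M r : ℝ) (s g : ℝ) : ℝ := max (-r) (min r (s * g / M))

lemma abs_shift_le {M r : ℝ} (hr : 0 ≤ r) (s g : ℝ) : |shift M r s g| ≤ r := by
  rw [shift, abs_le]
  exact ⟨le_max_left _ _, max_le (by linarith) (min_le_left _ _)⟩

/-- The division by `M` in `shift` serves this bound: for an `M`-Lipschitz gradient the displacement
is 1-Lipschitz in the position, so jumps of equal sign cannot overtake each other. -/
lemma abs_shift_sub_le {M r : ℝ} (hM : 0 < M) {s g g' : ℝ} (hs : |s| = 1) :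
    |shift M r s g - shift M r s g'| ≤ |g - g'| / M := by
  have h1 : |s * g / M - s * g' / M| = |g - g'| / M := by
    rw [← sub_div, ← mul_sub, abs_div, abs_mul, hs, one_mul, abs_of_pos hM]
  rw [← h1, shift, shift]
  refine (abs_max_sub_max_le_max _ _ _ _).trans (max_le (by simp) ?_)
  exact (abs_min_sub_min_le_max _ _ _ _).trans (by simp)

/-- Where the clamp is active, the full gain `|g| * r` is attained. Elsewhere `|g| ≤ M * r`, so the
left side is nonpositive while the right side is nonnegative. -/
lemma le_mul_shift {M r : ℝ} (hM : 0 < M) (hr : 0 ≤ r) (c g : ℝ) :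
    |c| * (|g| * r - M * r ^ 2) ≤ c * shift M r (SignType.sign c : ℝ) g * g := by
  have key : ∀ u : ℝ, |u| * r - M * r ^ 2 ≤ max (-r) (min r (u / M)) * u := by
    intro u
    have hMr : 0 ≤ M * r ^ 2 := by positivity
    rcases le_total r (u / M) with h | h
    · rw [min_eq_left h, max_eq_right (by linarith)]
      have : 0 ≤ u := by
        rw [le_div_iff₀ hM] at h
        exact (mul_nonneg hr hM.le).trans h
      rw [abs_of_nonneg this]
      linarith
    · rw [min_eq_right h]
      rcases le_total (u / M) (-r) with h' | h'
      · rw [max_eq_left h']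
        have : u ≤ 0 := by
          rw [div_le_iff₀ hM] at h'
          nlinarith
        rw [abs_of_nonpos this]
        linarith
      · rw [max_eq_right h']
        have h1 : |u| ≤ M * r := by
          rw [abs_le]
          rw [div_le_iff₀ hM] at h
          rw [le_div_iff₀ hM] at h'
          constructor <;> linarith
        have h2 : 0 ≤ u / M * u := by
          rw [div_mul_eq_mul_div]
          exact div_nonneg (mul_self_nonneg u) hM.le
        nlinarith
  rcases lt_trichotomy c 0 with h | rfl | h
  · have := mul_le_mul_of_nonneg_left (key (-g)) (neg_nonneg.2 h.le)
    rw [abs_neg] at this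
    rw [sign_neg h, abs_of_neg h, shift]
    simp only [SignType.coe_neg, SignType.coe_one, neg_one_mul]
    linarith
  · simp
  · have := mul_le_mul_of_nonneg_left (key g) h.le
    rw [sign_pos h, abs_of_pos h, shift]
    simp only [SignType.coe_one, one_mul]
    linarith

section Competitors

variable {W : Finset ℤ} {n : ℕ} {a : ℤ} {P : Finset ℝ} {J : ℝ → ℤ} {x : L1}

/-- Moving the jumps without changing their order leads to a feasible point. -/
lemma IsSwitchRep.exists_moved (h : IsSwitchRep W n a P J x) {φ : ℝ → ℝ}
    (hφ : MonotoneOn φ P) :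
    ∃ w ∈ switchSpace W n, (totalVariation w).toReal ≤ ((∑ p ∈ P, |J p| : ℤ) : ℝ) ∧
      w =ᵐ[unitMeasure] fun t => a + ∑ p ∈ P, (J p : ℝ) * heaviside (φ p) t := by
  classical
  obtain ⟨b, Q, K, -, -, hcard, hsum, hval⟩ := exists_stepFun_eq_sum a P φ J
  obtain ⟨w, hw⟩ := exists_isStep b Q K
  refine ⟨w, hw.mem_switchSpace (hcard.trans h.card_le) fun t ht => ?_,
    hw.toReal_totalVariation_le.trans (by exact_mod_cast hsum), ?_⟩
  · rw [hval t ht]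
    -- Since `φ` is monotone, the jumps that are passed before `t` form an initial segment of `P`.
    -- The original function has the same value at the first jump not passed, or beyond the last
    -- jump if all are passed.
    have hs : ∃ s ∈ Ioo (0 : ℝ) 1, ∀ p ∈ P, φ p < t ↔ p < s := by
      rcases (P.filter fun p => ¬ φ p < t).eq_empty_or_nonempty with hU | hU
      · rw [Finset.filter_eq_empty_iff] at hU
        rcases P.eq_empty_or_nonempty with rfl | hne
        · exact ⟨t, ht, by simp⟩
        · have hm := h.mem_Ioo _ (P.max'_mem hne)
          refine ⟨(P.max' hne + 1) / 2, ⟨by linarith [hm.1], by linarith [hm.2]⟩, fun p hp => ?_⟩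
          refine ⟨fun _ => ?_, fun _ => not_not.1 (hU hp)⟩
          have := P.le_max' p hp
          linarith [hm.2]
      · have hm := Finset.min'_mem _ hU
        rw [Finset.mem_filter] at hm
        refine ⟨_, h.mem_Ioo _ hm.1, fun p hp => ⟨fun hpt => ?_, fun hps => ?_⟩⟩
        · by_contra hcon
          exact hm.2 ((hφ hm.1 hp (not_lt.1 hcon)).trans_lt hpt)
        · by_contra hcon
          exact absurd (Finset.min'_le _ p (Finset.mem_filter.2 ⟨hp, hcon⟩)) (not_le.2 hps)
    obtain ⟨s, hs, hs'⟩ := hs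
    rw [Finset.filter_congr hs']
    exact h.mem s hs
  · filter_upwards [hw, ae_restrict_mem measurableSet_Ioo] with t h1 h2
    rw [h1, hval t h2, Finset.sum_filter, Int.cast_add, Int.cast_sum]
    congr 1
    refine Finset.sum_congr rfl fun p _ => ?_
    simp only [heaviside]
    split_ifs <;> simp

/-- The moved function is the competitor: its variation does not increase, and each jump travels at
most `r`. Of the error `2 * M * r ^ 2` per unit of jump, one half is the loss from clamping and the
other the variation of `G` along the displacement. -/
lemma IsSwitchRep.le_predicted_of_moved (h : IsSwitchRep W n a P J x) {A : Set L1}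
    (hA : switchSpace W n ⊆ A) {gradF : L1 → LInf} {G : ℝ → ℝ} {M : ℝ} (hM : 0 < M)
    (hGL : LipschitzWith M.toNNReal G) (hG : G =ᵐ[unitMeasure] gradF x) {r Δ : ℝ} (hr : 0 ≤ r)
    (hΔ : r * (∑ p ∈ P, |J p| : ℤ) ≤ Δ)
    (hmono : MonotoneOn (fun p => p + shift M r (SignType.sign (J p : ℝ) : ℝ) (G p)) P)
    (hmem : ∀ p ∈ P, p + shift M r (SignType.sign (J p : ℝ) : ℝ) (G p) ∈ Icc (0 : ℝ) 1) :
    r * ∑ p ∈ P, |G p| * |(J p : ℝ)| - 2 * M * r ^ 2 * (∑ p ∈ P, |J p| : ℤ) ≤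
      predicted gradF A x Δ := by
  obtain ⟨w, hwX, hwTV, hw⟩ := h.exists_moved hmono
  set τ : ℝ → ℝ := fun p => shift M r (SignType.sign (J p : ℝ) : ℝ) (G p) with hτ
  have hx : x =ᵐ[unitMeasure] fun t => a + ∑ p ∈ P, (J p : ℝ) * heaviside p t := by
    filter_upwards [h.isStep] with t ht
    rw [ht, stepFun_cast]
  have hdist : dist w x ≤ Δ := by
    refine le_trans ?_ hΔ
    rw [dist_L1_eq hw hx]
    have hi : ∀ p ∈ P, Integrable (fun t => |(J p : ℝ)| *
        |heaviside (p + τ p) t - heaviside p t|) unitMeasure := by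
      intro p _
      refine Integrable.const_mul (Integrable.abs ?_) _
      have hi : ∀ q, Integrable (heaviside q) unitMeasure := fun q => by
        simpa using integrable_mul_heaviside (integrable_const (1 : ℝ)) q
      exact (hi _).sub (hi _)
    calc ∫ t, |(a + ∑ p ∈ P, (J p : ℝ) * heaviside (p + τ p) t) -
          (a + ∑ p ∈ P, (J p : ℝ) * heaviside p t)| ∂unitMeasure
        ≤ ∫ t, ∑ p ∈ P, |(J p : ℝ)| * |heaviside (p + τ p) t - heaviside p t| ∂unitMeasure := by
          refine integral_mono_of_nonneg (Eventually.of_forall fun t => abs_nonneg _)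
            (integrable_finsetSum _ hi) (Eventually.of_forall fun t => ?_)
          simp only [add_sub_add_left_eq_sub, ← Finset.sum_sub_distrib, ← mul_sub, ← abs_mul]
          exact Finset.abs_sum_le_sum_abs _ _
      _ = ∑ p ∈ P, |(J p : ℝ)| * ∫ t, |heaviside (p + τ p) t - heaviside p t| ∂unitMeasure := by
          rw [integral_finsetSum _ hi]
          simp_rw [integral_const_mul]
      _ ≤ ∑ p ∈ P, |(J p : ℝ)| * r := by
          refine Finset.sum_le_sum fun p _ => mul_le_mul_of_nonneg_left ?_ (abs_nonneg _)
          refine (integral_abs_heaviside_sub_le _ _).trans ?_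
          rw [add_sub_cancel_left]
          exact abs_shift_le hr _ _
      _ = r * (∑ p ∈ P, |J p| : ℤ) := by
          rw [← Finset.sum_mul, mul_comm]
          push_cast
          rfl
  have hGi : Integrable G unitMeasure := integrable_of_continuous hGL.continuous
  have hint : ∫ t, gradF x t * (w t - x t) ∂unitMeasure =
      ∑ p ∈ P, (J p : ℝ) * ∫ t in (p + τ p)..p, G t := by
    have h1 : ∫ t, gradF x t * (w t - x t) ∂unitMeasure = ∫ t, ∑ p ∈ P, (J p : ℝ) *
        (G t * heaviside (p + τ p) t - G t * heaviside p t) ∂unitMeasure := by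
      refine integral_congr_ae ?_
      filter_upwards [hw, hx, hG] with t h1 h2 h3
      rw [h1, h2, ← h3, add_sub_add_left_eq_sub, ← Finset.sum_sub_distrib, Finset.mul_sum]
      refine Finset.sum_congr rfl fun p _ => ?_
      ring
    rw [h1, integral_finsetSum]
    · refine Finset.sum_congr rfl fun p hp => ?_
      have hp' := h.mem_Ioo p hp
      rw [integral_const_mul, integral_sub (integrable_mul_heaviside hGi _)
        (integrable_mul_heaviside hGi _), integral_mul_heaviside G (hmem p hp),
        integral_mul_heaviside G ⟨hp'.1.le, hp'.2.le⟩,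
        intervalIntegral.integral_interval_sub_interval_comm
          (hGL.continuous.intervalIntegrable _ _) (hGL.continuous.intervalIntegrable _ _)
          (hGL.continuous.intervalIntegrable _ _), intervalIntegral.integral_same, sub_zero]
    · exact fun p _ => ((integrable_mul_heaviside hGi _).sub
        (integrable_mul_heaviside hGi _)).const_mul _
  have hle : ∑ p ∈ P, (J p : ℝ) * ∫ t in (p + τ p)..p, G t ≤
      -(r * ∑ p ∈ P, |G p| * |(J p : ℝ)| - 2 * M * r ^ 2 * (∑ p ∈ P, |J p| : ℤ)) := by
    push_cast
    rw [Finset.mul_sum, Finset.mul_sum, ← Finset.sum_sub_distrib, ← Finset.sum_neg_distrib]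
    refine Finset.sum_le_sum fun p _ => ?_
    have h1 := mul_integral_le_of_lipschitz hM.le hGL (J p : ℝ) p (τ p)
    have h2 := le_mul_shift hM hr (J p : ℝ) (G p)
    have h3 : τ p ^ 2 ≤ r ^ 2 := by
      rw [← sq_abs]
      exact pow_le_pow_left₀ (abs_nonneg _) (abs_shift_le hr _ _) 2
    have h4 : |(J p : ℝ)| * (M * τ p ^ 2) ≤ |(J p : ℝ)| * (M * r ^ 2) :=
      mul_le_mul_of_nonneg_left (mul_le_mul_of_nonneg_left h3 hM.le) (abs_nonneg _)
    simp only [hτ] at h1 h4 ⊢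
    linarith
  refine le_trans ?_ (neg_trObjective_le_predicted (hA hwX) hdist)
  rw [trObjective, hint, h.totalVariation_eq]
  linarith

end Competitors

/-! ### Bumps -/

/-- `(p, q]` is a maximal interval on which the step function with jumps `J` at `P` is constant, and
an extremum of it: a local maximum for `ε = 1`, a local minimum for `ε = -1`. -/
structure IsBump (P : Finset ℝ) (J : ℝ → ℤ) (p q : ℝ) (ε : ℤ) : Prop where
  sign : ε = 1 ∨ ε = -1
  left : p ∈ P ∨ p = 0
  right : q ∈ P ∨ q = 1
  mem : p ∈ P ∨ q ∈ P
  lt : p < q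
  gap : ∀ r ∈ P, r ≤ p ∨ q ≤ r
  left_pos : p ∈ P → 0 < ε * J p
  right_neg : q ∈ P → ε * J q < 0

lemma exists_sign_mul_pos {k : ℤ} (hk : k ≠ 0) : ∃ ε : ℤ, (ε = 1 ∨ ε = -1) ∧ 0 < ε * k := by
  rcases lt_or_gt_of_ne hk with h | h
  · exact ⟨-1, Or.inr rfl, by linarith⟩
  · exact ⟨1, Or.inl rfl, by linarith⟩

section Bump

variable {W : Finset ℤ} {n : ℕ} {a : ℤ} {P : Finset ℝ} {J : ℝ → ℤ} {x : L1} {p q : ℝ} {ε : ℤ}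

lemma exists_isBump_left (hP : ∀ p ∈ P, p ∈ Ioo (0 : ℝ) 1) (hJ : ∀ p ∈ P, J p ≠ 0) (hp : p ∈ P) :
    ∃ r ε, r ≤ p ∧ IsBump P J 0 r ε := by
  have hm := P.min'_mem ⟨p, hp⟩
  obtain ⟨ε, hε, h⟩ := exists_sign_mul_pos (hJ _ hm)
  refine ⟨P.min' ⟨p, hp⟩, -ε, P.min'_le p hp, ?_, Or.inr rfl, Or.inl hm, Or.inr hm,
    (hP _ hm).1, fun r hr => Or.inr (P.min'_le r hr), fun h0 => absurd (hP _ h0).1 (lt_irrefl _),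
    fun _ => by linarith⟩
  rcases hε with rfl | rfl <;> simp

lemma exists_isBump_right (hP : ∀ p ∈ P, p ∈ Ioo (0 : ℝ) 1) (hJ : ∀ p ∈ P, J p ≠ 0) (hp : p ∈ P) :
    ∃ r ε, p ≤ r ∧ IsBump P J r 1 ε := by
  have hm := P.max'_mem ⟨p, hp⟩
  obtain ⟨ε, hε, h⟩ := exists_sign_mul_pos (hJ _ hm)
  exact ⟨P.max' ⟨p, hp⟩, ε, P.le_max' p hp, hε, Or.inl hm, Or.inr rfl, Or.inl hm,
    (hP _ hm).2, fun r hr => Or.inl (P.le_max' r hr), fun _ => h,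
    fun h0 => absurd (hP _ h0).2 (lt_irrefl _)⟩

/-- Take `p'` as the last jump before `q` with the sign of `J p`, and `q'` as its successor. Then
`q'` has the opposite sign, either by maximality of `p'` or because it is `q`. -/
lemma exists_isBump_between (hJ : ∀ p ∈ P, J p ≠ 0) (hp : p ∈ P) (hq : q ∈ P) (hpq : p < q)
    (hneg : J p * J q < 0) : ∃ p' q' ε, p ≤ p' ∧ q' ≤ q ∧ IsBump P J p' q' ε := by
  classical
  obtain ⟨ε, hε, hεp⟩ := exists_sign_mul_pos (hJ p hp)
  have hεq : ε * J q < 0 := by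
    rcases hε with rfl | rfl <;> nlinarith
  have hL : (P.filter fun r => r < q ∧ 0 < ε * J r).Nonempty :=
    ⟨p, Finset.mem_filter.2 ⟨hp, hpq, hεp⟩⟩
  set p' := Finset.max' _ hL with hp'
  have hp'm := Finset.max'_mem _ hL
  rw [← hp', Finset.mem_filter] at hp'm
  have hR : (P.filter fun r => p' < r).Nonempty := ⟨q, Finset.mem_filter.2 ⟨hq, hp'm.2.1⟩⟩
  set q' := Finset.min' _ hR with hq'
  have hq'm := Finset.min'_mem _ hR
  rw [← hq', Finset.mem_filter] at hq'm
  have hq'q : q' ≤ q := Finset.min'_le _ _ (Finset.mem_filter.2 ⟨hq, hp'm.2.1⟩)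
  refine ⟨p', q', ε, Finset.le_max' _ _ (Finset.mem_filter.2 ⟨hp, hpq, hεp⟩), hq'q, hε,
    Or.inl hp'm.1, Or.inl hq'm.1, Or.inl hp'm.1, hq'm.2, fun r hr => ?_, fun _ => hp'm.2.2,
    fun _ => ?_⟩
  · rcases le_or_gt r p' with h | h
    · exact Or.inl h
    · exact Or.inr (Finset.min'_le _ _ (Finset.mem_filter.2 ⟨hr, h⟩))
  · rcases hq'q.eq_or_lt with h | h
    · rwa [h]
    · refine lt_of_le_of_ne (not_lt.1 fun hpos => ?_) ?_
      · exact absurd (Finset.le_max' _ _ (Finset.mem_filter.2 ⟨hq'm.1, h, hpos⟩)) (not_le.2 hq'm.2)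
      · refine mul_ne_zero ?_ (hJ _ hq'm.1)
        rcases hε with rfl | rfl <;> simp

/-- The length of the shortest bump, in units of `1 / D` and truncated at `1`. -/
lemma exists_min_bump (P : Finset ℝ) (J : ℝ → ℤ) {D : ℝ} (hD : 0 < D) :
    ∃ d : ℝ, 0 < d ∧ d ≤ 1 ∧ (∀ p q ε, IsBump P J p q ε → d ≤ D * (q - p)) ∧
      (d = 1 ∨ ∃ p q ε, IsBump P J p q ε ∧ d = D * (q - p)) := by
  classical
  -- The endpoints of a bump lie in `P` or are 0 and 1, so only finitely many lengths occur.
  set S : Finset ℝ := insert 1 ((((insert 0 P) ×ˢ (insert 1 P)).filter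
    fun z : ℝ × ℝ => ∃ ε, IsBump P J z.1 z.2 ε).image fun z => D * (z.2 - z.1)) with hS
  have hne : S.Nonempty := Finset.insert_nonempty _ _
  have hmem : S.min' hne = 1 ∨ ∃ p q ε, IsBump P J p q ε ∧ S.min' hne = D * (q - p) := by
    rcases Finset.mem_insert.1 (S.min'_mem hne) with h | h
    · exact Or.inl h
    · obtain ⟨⟨p, q⟩, hz, hz'⟩ := Finset.mem_image.1 h
      obtain ⟨ε, hε⟩ := (Finset.mem_filter.1 hz).2
      exact Or.inr ⟨p, q, ε, hε, hz'.symm⟩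
  refine ⟨S.min' hne, ?_, S.min'_le 1 (Finset.mem_insert_self _ _), fun p q ε h => ?_, hmem⟩
  · rcases hmem with h | ⟨p, q, ε, h, h'⟩
    · rw [h]; exact one_pos
    · rw [h']; exact mul_pos hD (sub_pos.2 h.lt)
  · refine S.min'_le _ (Finset.mem_insert_of_mem (Finset.mem_image.2 ⟨(p, q), ?_, rfl⟩))
    refine Finset.mem_filter.2 ⟨Finset.mem_product.2 ⟨?_, ?_⟩, ε, h⟩
    · exact Finset.mem_insert.2 h.left.symm
    · exact Finset.mem_insert.2 h.right.symm

namespace IsBump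

lemma nonneg_left (hb : IsBump P J p q ε) (hP : ∀ p ∈ P, p ∈ Ioo (0 : ℝ) 1) : 0 ≤ p := by
  rcases hb.left with h | h
  · exact (hP p h).1.le
  · exact h.ge

lemma right_le_one (hb : IsBump P J p q ε) (hP : ∀ p ∈ P, p ∈ Ioo (0 : ℝ) 1) : q ≤ 1 := by
  rcases hb.right with h | h
  · exact (hP q h).2.le
  · exact h.le

lemma stepFun_eq (hb : IsBump P J p q ε) (a : ℤ) {t : ℝ} (hpt : p < t) (htq : t ≤ q) :
    stepFun a P J t = stepFun a P J q := by
  refine stepFun_congr fun r hr => ⟨fun h => h.trans_le htq, fun h => ?_⟩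
  rcases hb.gap r hr with h' | h'
  · exact h'.trans_lt hpt
  · exact absurd h (not_lt.2 h')

lemma stepFun_right (hb : IsBump P J p q ε) (a : ℤ) (hp : p ∈ P) :
    stepFun a P J q = stepFun a P J p + J p := by
  rw [← sub_eq_iff_eq_add', stepFun_sub hb.lt.le, Finset.filter_congr (q := fun r => r = p),
    Finset.filter_eq', if_pos hp, Finset.sum_singleton]
  intro r hr
  refine ⟨fun h => ?_, ?_⟩
  · rcases hb.gap r hr with h' | h'
    · exact le_antisymm h' h.1
    · exact absurd h.2 (not_lt.2 h')
  · rintro rfl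
    exact ⟨le_rfl, hb.lt⟩

lemma mul_self_sign (hb : IsBump P J p q ε) : ε * ε = 1 := by
  rcases hb.sign with h | h <;> simp [h]

/-- The value is read off at the midpoint, because `q = 1` is possible and values are controlled on
the open interval only. -/
lemma stepFun_right_mem (hb : IsBump P J p q ε) (h : IsSwitchRep W n a P J x) :
    stepFun a P J q ∈ W := by
  have h1 := hb.nonneg_left h.mem_Ioo
  have h2 := hb.right_le_one h.mem_Ioo
  have h3 := hb.lt
  rw [← hb.stepFun_eq a (t := (p + q) / 2) (by linarith) (by linarith)]
  exact h.mem _ ⟨by linarith, by linarith⟩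

/-- The distance from the value on a bump to the nearest admissible value in the direction in which
the bump is flattened. -/
lemma exists_height (hb : IsBump P J p q ε) (h : IsSwitchRep W n a P J x) :
    ∃ η : ℤ, 1 ≤ η ∧ stepFun a P J q - ε * η ∈ W ∧
      ∀ k ∈ W, 0 < ε * (stepFun a P J q - k) → η ≤ ε * (stepFun a P J q - k) := by
  -- A genuine endpoint of the bump supplies the value on its other side, which lies in `W` in the
  -- required direction.
  have hne : (W.filter fun k => 0 < ε * (stepFun a P J q - k)).Nonempty := by
    rcases hb.mem with hp | hq
    · refine ⟨stepFun a P J p, Finset.mem_filter.2 ⟨h.mem p (h.mem_Ioo p hp), ?_⟩⟩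
      rw [hb.stepFun_right a hp, add_sub_cancel_left]
      exact hb.left_pos hp
    · refine ⟨stepFun a P J q + J q, Finset.mem_filter.2 ⟨h.add_mem hq, ?_⟩⟩
      have := hb.right_neg hq
      linarith
  obtain ⟨k, hk, hmin⟩ := Finset.exists_min_image _ (fun k => ε * (stepFun a P J q - k)) hne
  rw [Finset.mem_filter] at hk
  refine ⟨ε * (stepFun a P J q - k), hk.2, ?_, fun l hl hl' =>
    hmin l (Finset.mem_filter.2 ⟨hl, hl'⟩)⟩
  rw [← mul_assoc, hb.mul_self_sign, one_mul, sub_sub_cancel]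
  exact hk.1

/-- Flattening a bump decreases the total variation. -/
lemma exists_flattened (hb : IsBump P J p q ε) (h : IsSwitchRep W n a P J x) {η : ℤ} (hη : 1 ≤ η)
    (hmem : stepFun a P J q - ε * η ∈ W)
    (hmin : ∀ k ∈ W, 0 < ε * (stepFun a P J q - k) → η ≤ ε * (stepFun a P J q - k)) :
    ∃ w ∈ switchSpace W n, (totalVariation w).toReal + 1 ≤ (totalVariation x).toReal ∧
      dist w x = η * (q - p) := by
  classical
  have hη0 : 0 ≤ η := by linarith
  -- Subtracting `ε * η` on `(p, q]` changes the jumps at `p` and `q`. If `p = 0` is no jump point,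
  -- the change at `p` goes into the constant `a'`; if `q = 1` is none, the change at `q` is not
  -- seen.
  set J' : ℝ → ℤ := fun r => J r + ((if r = q then ε * η else 0) - if r = p then ε * η else 0)
    with hJ'
  set a' : ℤ := a - if p ∈ P then 0 else ε * η with ha'
  have hp0 := hb.nonneg_left h.mem_Ioo
  have hq1 := hb.right_le_one h.mem_Ioo
  have hval : ∀ t ∈ Ioo (0 : ℝ) 1, stepFun a' P J' t =
      stepFun a P J t - if p < t ∧ t ≤ q then ε * η else 0 := by
    intro t ht
    have h1 : ∀ r, (∑ s ∈ P with s < t, if s = r then ε * η else 0) =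
        if r ∈ P ∧ r < t then ε * η else 0 := by
      intro r
      rw [Finset.sum_ite_eq']
      simp only [Finset.mem_filter]
    simp only [stepFun, hJ', ha', Finset.sum_add_distrib, Finset.sum_sub_distrib, h1]
    have h2 : (if p ∈ P then 0 else ε * η) + (if p ∈ P ∧ p < t then ε * η else 0) =
        if p < t then ε * η else 0 := by
      by_cases hp : p ∈ P
      · simp [hp]
      · have hpt : p < t := by rw [hb.left.resolve_left hp]; exact ht.1
        simp [hp, hpt]
    have h3 : (if q ∈ P ∧ q < t then ε * η else 0) = if q < t then ε * η else 0 := by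
      by_cases hq : q ∈ P
      · simp [hq]
      · have hqt : ¬ q < t := by rw [hb.right.resolve_left hq]; exact not_lt.2 ht.2.le
        simp [hq, hqt]
    have h4 : (if p < t ∧ t ≤ q then ε * η else 0) =
        (if p < t then ε * η else 0) - if q < t then ε * η else 0 := by
      rcases lt_or_ge q t with hqt | hqt
      · simp [hqt, not_le.2 hqt, hb.lt.trans hqt]
      · simp [hqt, not_lt.2 hqt]
    rw [h4, ← h2, h3]
    ring
  have hpJ : p ∈ P → η ≤ ε * J p := fun hp => by
    have h1 := hmin _ (h.mem p (h.mem_Ioo p hp))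
    rw [hb.stepFun_right a hp, add_sub_cancel_left] at h1
    exact h1 (hb.left_pos hp)
  have hqJ : q ∈ P → η ≤ -(ε * J q) := fun hq => by
    have h1 := hmin _ (h.add_mem hq)
    have h2 := hb.right_neg hq
    have h3 : ε * (stepFun a P J q - (stepFun a P J q + J q)) = -(ε * J q) := by ring
    rw [h3] at h1
    exact h1 (by linarith)
  have hpq : p ≠ q := hb.lt.ne
  -- As `η` is the distance to the nearest admissible value, it does not exceed the jumps at the
  -- ends of the bump. No jump changes its sign, and each affected one shrinks by exactly `η`.
  have habs : ∀ r ∈ P, |J' r| + ((if r = p then η else 0) + if r = q then η else 0) ≤ |J r| := by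
    intro r hr
    by_cases h1 : r = p
    · subst h1
      have h2 := hpJ hr
      simp only [hJ', if_true, if_neg hpq]
      rcases hb.sign with rfl | rfl
      · rw [abs_of_nonneg (by linarith), abs_of_nonneg (by linarith)]; linarith
      · rw [abs_of_nonpos (by linarith), abs_of_nonpos (by linarith)]; linarith
    · by_cases h3 : r = q
      · subst h3
        have h2 := hqJ hr
        simp only [hJ', if_true, if_neg h1]
        rcases hb.sign with rfl | rfl
        · rw [abs_of_nonpos (by linarith), abs_of_nonpos (by linarith)]; linarith
        · rw [abs_of_nonneg (by linarith), abs_of_nonneg (by linarith)]; linarith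
      · simp [hJ', h1, h3]
  have hsum : ∑ r ∈ P, |J' r| + 1 ≤ ∑ r ∈ P, |J r| := by
    have h1 := Finset.sum_le_sum habs
    rw [Finset.sum_add_distrib, Finset.sum_add_distrib, Finset.sum_ite_eq',
      Finset.sum_ite_eq'] at h1
    rcases hb.mem with hp | hq
    · rw [if_pos hp] at h1
      have : 0 ≤ if q ∈ P then η else 0 := by split_ifs <;> linarith
      linarith
    · rw [if_pos hq] at h1
      have : 0 ≤ if p ∈ P then η else 0 := by split_ifs <;> linarith
      linarith
  obtain ⟨w, hw⟩ := exists_isStep a' P J'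
  refine ⟨w, hw.mem_switchSpace h.card_le fun t ht => ?_, ?_, ?_⟩
  · rw [hval t ht]
    split_ifs with hpt
    · rwa [hb.stepFun_eq a hpt.1 hpt.2]
    · rw [sub_zero]; exact h.mem t ht
  · rw [h.totalVariation_eq]
    have h1 := hw.toReal_totalVariation_le
    have h2 : ((∑ r ∈ P, |J' r| : ℤ) : ℝ) + 1 ≤ ((∑ r ∈ P, |J r| : ℤ) : ℝ) := by exact_mod_cast hsum
    linarith
  · rw [dist_L1_eq hw h.isStep]
    have h1 : ∫ t, |(stepFun a' P J' t : ℝ) - stepFun a P J t| ∂unitMeasure =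
        ∫ t, (Ioc p q).indicator (fun _ => (η : ℝ)) t ∂unitMeasure := by
      refine integral_congr_ae ?_
      filter_upwards [ae_restrict_mem measurableSet_Ioo] with t ht
      rw [hval t ht, Int.cast_sub, sub_sub_cancel_left, abs_neg]
      by_cases hpt : p < t ∧ t ≤ q
      · rw [if_pos hpt, indicator_of_mem (show t ∈ Ioc p q from hpt), Int.cast_mul, abs_mul]
        have h3 : |(ε : ℝ)| = 1 := by rcases hb.sign with rfl | rfl <;> simp
        rw [h3, one_mul, abs_of_nonneg (by exact_mod_cast hη0)]
      · rw [if_neg hpt, indicator_of_notMem (show t ∉ Ioc p q from hpt)]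
        simp
    rw [h1, setIntegral_indicator measurableSet_Ioc, setIntegral_const, smul_eq_mul, mul_comm]
    congr 1
    have h2 : (Ioo (0 : ℝ) 1 ∩ Ioc p q : Set ℝ) =ᵐ[volume] (Ioc p q : Set ℝ) := by
      have h3 : Ioo (0 : ℝ) 1 ∩ Ioo p q = Ioo p q :=
        inter_eq_right.2 fun t ht => ⟨hp0.trans_lt ht.1, ht.2.trans_le hq1⟩
      have h4 := ae_eq_set_inter (ae_eq_refl (μ := volume) (Ioo (0 : ℝ) 1))
        (Ioo_ae_eq_Ioc (μ := volume) (a := p) (b := q))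
      rw [h3] at h4
      exact h4.symm.trans Ioo_ae_eq_Ioc
    rw [measureReal_congr h2, Real.volume_real_Ioc_of_le hb.lt.le]

/-- The unit gain of variation is set against the gradient term, at most `M` times the area of the
flattened bump. -/
lemma le_predicted (hb : IsBump P J p q ε) (h : IsSwitchRep W n a P J x) {A : Set L1}
    (hA : switchSpace W n ⊆ A) {gradF : L1 → LInf} {M Δ : ℝ} (hM : ‖gradF x‖ ≤ M) {η : ℤ}
    (hη : 1 ≤ η) (hmem : stepFun a P J q - ε * η ∈ W)
    (hmin : ∀ k ∈ W, 0 < ε * (stepFun a P J q - k) → η ≤ ε * (stepFun a P J q - k))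
    (hΔ : η * (q - p) ≤ Δ) : 1 - M * (η * (q - p)) ≤ predicted gradF A x Δ := by
  obtain ⟨w, hwX, hTV, hd⟩ := hb.exists_flattened h hη hmem hmin
  refine le_trans ?_ (neg_trObjective_le_predicted (hA hwX) (hd.trans_le hΔ))
  have h1 := (le_abs_self _).trans (abs_integral_mul_sub_le (gradF x) x w)
  have h2 := mul_le_mul_of_nonneg_right hM (dist_nonneg (x := w) (y := x))
  rw [hd] at h1 h2
  rw [trObjective]
  linarith

end IsBump

end Bump

/-! ### The first-order lower bound for small radii. -/

section LowerBound

variable {W : Finset ℤ} {n : ℕ} {a : ℤ} {P : Finset ℝ} {J : ℝ → ℤ} {x : L1}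

/-- Every bump has length at least `2 * r`. Jumps of opposite sign have a bump between them and
cannot cross when each moves by at most `r`; for jumps of equal sign the 1-Lipschitz displacement
preserves the order. The bumps adjacent to 0 and 1 keep all jumps inside `[0, 1]`. -/
lemma IsSwitchRep.le_predicted (h : IsSwitchRep W n a P J x) {A : Set L1}
    (hA : switchSpace W n ⊆ A) {gradF : L1 → LInf} {G : ℝ → ℝ} {M : ℝ} (hM : 0 < M)
    (hGL : LipschitzWith M.toNNReal G) (hG : G =ᵐ[unitMeasure] gradF x) {r Δ d D : ℝ}
    (hr : 0 ≤ r) (hD : 0 < D) (hd : ∀ p q ε, IsBump P J p q ε → d ≤ D * (q - p))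
    (hrd : 2 * D * r ≤ d) (hΔ : r * (∑ p ∈ P, |J p| : ℤ) ≤ Δ) :
    r * ∑ p ∈ P, |G p| * |(J p : ℝ)| - 2 * M * r ^ 2 * (∑ p ∈ P, |J p| : ℤ) ≤
      predicted gradF A x Δ := by
  have hlen : ∀ p q ε, IsBump P J p q ε → 2 * r ≤ q - p := fun p q ε hb => by
    have := hrd.trans (hd p q ε hb)
    rw [mul_comm 2 D, mul_assoc] at this
    exact le_of_mul_le_mul_left this hD
  refine h.le_predicted_of_moved hA hM hGL hG hr hΔ ?_ fun p hp => ?_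
  · intro p hp q hq hpq
    rcases hpq.eq_or_lt with rfl | hpq
    · exact le_rfl
    have hJp := h.ne_zero p hp
    have hJq := h.ne_zero q hq
    simp only
    rcases lt_or_gt_of_ne (mul_ne_zero hJp hJq) with hneg | hpos
    · obtain ⟨p', q', ε, h1, h2, hb⟩ := exists_isBump_between h.ne_zero hp hq hpq hneg
      have h3 := hlen _ _ _ hb
      have h4 := abs_le.1 (abs_shift_le (M := M) hr (SignType.sign (J p : ℝ) : ℝ) (G p))
      have h5 := abs_le.1 (abs_shift_le (M := M) hr (SignType.sign (J q : ℝ) : ℝ) (G q))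
      linarith [h4.2, h5.1]
    · have hsign : (SignType.sign (J p : ℝ) : ℝ) = SignType.sign (J q : ℝ) ∧
          |(SignType.sign (J q : ℝ) : ℝ)| = 1 := by
        rcases pos_and_pos_or_neg_and_neg_of_mul_pos hpos with ⟨h1, h2⟩ | ⟨h1, h2⟩
        · rw [sign_pos (Int.cast_pos.2 h1), sign_pos (Int.cast_pos.2 h2)]
          simp
        · rw [sign_neg (Int.cast_lt_zero.2 h1), sign_neg (Int.cast_lt_zero.2 h2)]
          simp
      rw [hsign.1]
      have h1 := abs_shift_sub_le (r := r) (g := G p) (g' := G q) hM hsign.2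
      have h2 := hGL.dist_le_mul p q
      rw [Real.coe_toNNReal _ hM.le, Real.dist_eq, Real.dist_eq, abs_sub_comm p q,
        abs_of_pos (sub_pos.2 hpq)] at h2
      rw [← div_le_iff₀' hM] at h2
      linarith [(le_abs_self _).trans (h1.trans h2)]
  · obtain ⟨p', ε, h1, hb⟩ := exists_isBump_left h.mem_Ioo h.ne_zero hp
    obtain ⟨q', ε', h2, hb'⟩ := exists_isBump_right h.mem_Ioo h.ne_zero hp
    have h3 := hlen _ _ _ hb
    have h4 := hlen _ _ _ hb'
    have h5 := abs_le.1 (abs_shift_le (M := M) hr (SignType.sign (J p : ℝ) : ℝ) (G p))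
    exact ⟨by linarith [h5.1], by linarith [h5.2]⟩

end LowerBound

/-! ### Comparison of the variations of two step functions -/

section Variation

variable {a b : ℤ} {P Q : Finset ℝ} {J K : ℝ → ℤ}

/-- While all jumps over `P` have sign `ε`, the variation of that function grows exactly like `ε`
times the function, whereas for any other step function it grows at least that fast. -/
lemma stepVar_sub_le_of_pos (b : ℤ) (Q : Finset ℝ) (K : ℝ → ℤ) (a : ℤ) {s t : ℝ} (hst : s ≤ t)
    {ε : ℤ} (hε : ε = 1 ∨ ε = -1) (h : ∀ r ∈ P, s ≤ r → r < t → 0 < ε * J r) :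
    stepVar Q K s - stepVar P J s - ε * (stepFun b Q K s - stepFun a P J s) ≤
      stepVar Q K t - stepVar P J t - ε * (stepFun b Q K t - stepFun a P J t) := by
  have h1 : stepVar P J t - stepVar P J s = ε * (stepFun a P J t - stepFun a P J s) := by
    rw [stepVar, stepVar, stepFun_sub hst, stepFun_sub hst, Finset.mul_sum]
    refine Finset.sum_congr rfl fun r hr => ?_
    rw [Finset.mem_filter] at hr
    have h2 := h r hr.1 hr.2.1 hr.2.2
    rw [← abs_of_pos h2, abs_mul]
    rcases hε with rfl | rfl <;> simp
  have h2 := abs_stepFun_sub_le (a := b) (P := Q) (J := K) hst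
  have h3 : ε * (stepFun b Q K t - stepFun b Q K s) ≤ |stepFun b Q K t - stepFun b Q K s| := by
    refine (le_abs_self _).trans ?_
    rw [abs_mul]
    rcases hε with rfl | rfl <;> simp
  linarith

lemma exists_pos_or_neg {ε k : ℤ} (hε : ε = 1 ∨ ε = -1) (hk : k ≠ 0) :
    0 < ε * k ∨ 0 < -ε * k := by
  rcases lt_or_gt_of_ne hk with h | h <;> rcases hε with rfl | rfl
  · right; linarith
  · left; linarith
  · left; linarith
  · right; linarith

lemma neg_sign {ε : ℤ} (hε : ε = 1 ∨ ε = -1) : -ε = 1 ∨ -ε = -1 := by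
  rcases hε with rfl | rfl <;> simp

/-- By the preceding monotonicity it suffices to have the inequality at one point between the
previous jump and `p`. If the previous jump has the same sign, induction provides it. Otherwise `p`
ends a bump of sign `-ε`: at the contact point on it the left side is nonpositive, and the variation
difference is nonnegative, by induction with sign `-ε` or, on the first bump, because the variation
over `P` is still 0. -/
lemma mul_le_stepVar_sub (hP : ∀ p ∈ P, p ∈ Ioo (0 : ℝ) 1) (hJ : ∀ p ∈ P, J p ≠ 0)
    (hbump : ∀ p q ε, IsBump P J p q ε →
      ∃ s ∈ Ioo p q, 0 ≤ ε * (stepFun b Q K s - stepFun a P J s)) (m : ℕ) :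
    ∀ p ∈ P, (P.filter (· < p)).card = m → ∀ (t : ℝ) (ε : ℤ), p < t → (∀ r ∈ P, r < t → r ≤ p) →
      (ε = 1 ∨ ε = -1) → 0 < ε * J p →
      ε * (stepFun b Q K t - stepFun a P J t) ≤ stepVar Q K t - stepVar P J t := by
  induction m using Nat.strong_induction_on with
  | _ m ih =>
  intro p hp hm t ε hpt hlast hε hpos
  suffices hs : ∃ s < p, (∀ r ∈ P, r < p → r < s) ∧
      ε * (stepFun b Q K s - stepFun a P J s) ≤ stepVar Q K s - stepVar P J s by
    obtain ⟨s, hsp, hs, hle⟩ := hs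
    have := stepVar_sub_le_of_pos (P := P) (J := J) b Q K a (hsp.trans hpt).le hε
      fun r hr hsr hrt => by
        rcases (hlast r hr hrt).eq_or_lt with rfl | h
        · exact hpos
        · exact absurd (hs r hr h) (not_lt.2 hsr)
    linarith
  rcases (P.filter (· < p)).eq_empty_or_nonempty with he | hne
  · rw [Finset.filter_eq_empty_iff] at he
    have hb : IsBump P J 0 p (-ε) := ⟨neg_sign hε, Or.inr rfl, Or.inl hp, Or.inr hp, (hP p hp).1,
      fun r hr => Or.inr (not_lt.1 (he hr)), fun h0 => absurd (hP _ h0).1 (lt_irrefl _),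
      fun _ => by linarith⟩
    obtain ⟨s, hs, hs'⟩ := hbump _ _ _ hb
    refine ⟨s, hs.2, fun r hr h => absurd h (he hr), ?_⟩
    rw [stepVar_eq_zero (P := P) fun r hr => hs.2.le.trans (not_lt.1 (he hr))]
    linarith [stepVar_nonneg Q K s]
  · set p' := Finset.max' _ hne with hp'
    have hm' := Finset.max'_mem _ hne
    rw [← hp', Finset.mem_filter] at hm'
    have hmax : ∀ r ∈ P, r < p → r ≤ p' := fun r hr h =>
      Finset.le_max' _ _ (Finset.mem_filter.2 ⟨hr, h⟩)
    have hcard : (P.filter (· < p')).card < m := by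
      rw [← hm]
      refine Finset.card_lt_card (Finset.ssubset_iff_of_subset (fun r hr => ?_) |>.2
        ⟨p', Finset.mem_filter.2 hm', fun h => lt_irrefl _ (Finset.mem_filter.1 h).2⟩)
      rw [Finset.mem_filter] at hr ⊢
      exact ⟨hr.1, hr.2.trans hm'.2⟩
    rcases exists_pos_or_neg hε (hJ p' hm'.1) with h | h
    · refine ⟨(p' + p) / 2, by linarith [hm'.2], fun r hr hrp => ?_, ?_⟩
      · linarith [hmax r hr hrp, hm'.2]
      · exact ih _ hcard p' hm'.1 rfl _ ε (by linarith [hm'.2])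
          (fun r hr hrs => hmax r hr (by linarith [hm'.2])) hε h
    · have hb : IsBump P J p' p (-ε) := ⟨neg_sign hε, Or.inl hm'.1, Or.inl hp, Or.inr hp, hm'.2,
        fun r hr => (lt_or_ge r p).imp (hmax r hr) id, fun _ => h, fun _ => by linarith⟩
      obtain ⟨s, hs, hs'⟩ := hbump _ _ _ hb
      refine ⟨s, hs.2, fun r hr hrp => (hmax r hr hrp).trans_lt hs.1, ?_⟩
      have := ih _ hcard p' hm'.1 rfl s (-ε) hs.1
        (fun r hr hrs => hmax r hr (hrs.trans hs.2)) (neg_sign hε) h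
      linarith

/-- The mirror image, by induction on the jumps to the right of `q`. It starts beyond the last jump,
where the variation over `P` has reached its total; this is where equality of the total variations
enters. -/
lemma stepVar_sub_le_mul (hP : ∀ p ∈ P, p ∈ Ioo (0 : ℝ) 1) (hJ : ∀ p ∈ P, J p ≠ 0)
    (hbump : ∀ p q ε, IsBump P J p q ε →
      ∃ s ∈ Ioo p q, 0 ≤ ε * (stepFun b Q K s - stepFun a P J s))
    (hTV : ∑ q ∈ Q, |K q| = ∑ p ∈ P, |J p|) (m : ℕ) :
    ∀ q ∈ P, (P.filter (q < ·)).card = m → ∀ (t : ℝ) (ε : ℤ), t ≤ q → (∀ r ∈ P, t ≤ r → q ≤ r) →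
      (ε = 1 ∨ ε = -1) → 0 < ε * J q →
      stepVar Q K t - stepVar P J t ≤ ε * (stepFun b Q K t - stepFun a P J t) := by
  induction m using Nat.strong_induction_on with
  | _ m ih =>
  intro q hq hm t ε htq hfirst hε hpos
  suffices hs : ∃ s > q, (∀ r ∈ P, q < r → s ≤ r) ∧
      stepVar Q K s - stepVar P J s ≤ ε * (stepFun b Q K s - stepFun a P J s) by
    obtain ⟨s, hsq, hs, hle⟩ := hs
    have := stepVar_sub_le_of_pos (P := P) (J := J) b Q K a (htq.trans_lt hsq).le hε
      fun r hr htr hrs => by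
        rcases (hfirst r hr htr).eq_or_lt with rfl | h
        · exact hpos
        · exact absurd (hs r hr h) (not_le.2 hrs)
    linarith
  rcases (P.filter (q < ·)).eq_empty_or_nonempty with he | hne
  · rw [Finset.filter_eq_empty_iff] at he
    have hb : IsBump P J q 1 ε := ⟨hε, Or.inl hq, Or.inr rfl, Or.inl hq, (hP q hq).2,
      fun r hr => Or.inl (not_lt.1 (he hr)), fun _ => hpos,
      fun h0 => absurd (hP _ h0).2 (lt_irrefl _)⟩
    obtain ⟨s, hs, hs'⟩ := hbump _ _ _ hb
    refine ⟨s, hs.1, fun r hr h => absurd h (he hr), ?_⟩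
    rw [stepVar_eq_of_forall_lt (P := P) fun r hr => (not_lt.1 (he hr)).trans_lt hs.1, ← hTV]
    linarith [stepVar_le Q K s]
  · set q' := Finset.min' _ hne with hq'
    have hm' := Finset.min'_mem _ hne
    rw [← hq', Finset.mem_filter] at hm'
    have hmin : ∀ r ∈ P, q < r → q' ≤ r := fun r hr h =>
      Finset.min'_le _ _ (Finset.mem_filter.2 ⟨hr, h⟩)
    have hcard : (P.filter (q' < ·)).card < m := by
      rw [← hm]
      refine Finset.card_lt_card (Finset.ssubset_iff_of_subset (fun r hr => ?_) |>.2
        ⟨q', Finset.mem_filter.2 hm', fun h => lt_irrefl _ (Finset.mem_filter.1 h).2⟩)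
      rw [Finset.mem_filter] at hr ⊢
      exact ⟨hr.1, hm'.2.trans hr.2⟩
    rcases exists_pos_or_neg hε (hJ q' hm'.1) with h | h
    · refine ⟨q', hm'.2, hmin, ?_⟩
      exact ih _ hcard q' hm'.1 rfl _ ε le_rfl (fun r _ hrs => hrs) hε h
    · have hb : IsBump P J q q' ε := ⟨hε, Or.inl hq, Or.inl hm'.1, Or.inl hq, hm'.2,
        fun r hr => (le_or_gt r q).imp id (hmin r hr), fun _ => hpos, fun _ => by linarith⟩
      obtain ⟨s, hs, hs'⟩ := hbump _ _ _ hb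
      refine ⟨s, hs.1, fun r hr hrp => hs.2.le.trans (hmin r hr hrp), ?_⟩
      have := ih _ hcard q' hm'.1 rfl s (-ε) hs.2.le
        (fun r hr hrs => hmin r hr (hs.1.trans_le hrs)) (neg_sign hε) h
      linarith

/-- If a second step function of the same total variation reaches every extremal value of a step
function, then the variation functions differ by no more than the functions. -/
lemma abs_stepVar_sub_le (hP : ∀ p ∈ P, p ∈ Ioo (0 : ℝ) 1) (hJ : ∀ p ∈ P, J p ≠ 0)
    (hbump : ∀ p q ε, IsBump P J p q ε →
      ∃ s ∈ Ioo p q, 0 ≤ ε * (stepFun b Q K s - stepFun a P J s))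
    (hTV : ∑ q ∈ Q, |K q| = ∑ p ∈ P, |J p|) (t : ℝ) :
    |stepVar Q K t - stepVar P J t| ≤ |stepFun b Q K t - stepFun a P J t| := by
  have hsign : ∀ ε k : ℤ, (ε = 1 ∨ ε = -1) → ε * k ≤ |k| ∧ -|k| ≤ ε * k := by
    intro ε k hε
    rw [and_comm, ← abs_le, abs_mul]
    rcases hε with rfl | rfl <;> simp
  rw [abs_le]
  constructor
  · rcases (P.filter (· < t)).eq_empty_or_nonempty with he | hne
    · rw [Finset.filter_eq_empty_iff] at he
      rw [stepVar_eq_zero (P := P) fun r hr => not_lt.1 (he hr)]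
      linarith [stepVar_nonneg Q K t, abs_nonneg (stepFun b Q K t - stepFun a P J t)]
    · have hm := Finset.max'_mem _ hne
      rw [Finset.mem_filter] at hm
      obtain ⟨ε, hε, hpos⟩ := exists_sign_mul_pos (hJ _ hm.1)
      have := mul_le_stepVar_sub hP hJ hbump _ _ hm.1 rfl t ε hm.2
        (fun r hr h => Finset.le_max' _ _ (Finset.mem_filter.2 ⟨hr, h⟩)) hε hpos
      linarith [(hsign ε (stepFun b Q K t - stepFun a P J t) hε).2]
  · rcases (P.filter (t ≤ ·)).eq_empty_or_nonempty with he | hne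
    · rw [Finset.filter_eq_empty_iff] at he
      rw [stepVar_eq_of_forall_lt (P := P) fun r hr => not_le.1 (he hr), ← hTV]
      linarith [stepVar_le Q K t, abs_nonneg (stepFun b Q K t - stepFun a P J t)]
    · have hm := Finset.min'_mem _ hne
      rw [Finset.mem_filter] at hm
      obtain ⟨ε, hε, hpos⟩ := exists_sign_mul_pos (hJ _ hm.1)
      have := stepVar_sub_le_mul hP hJ hbump hTV _ _ hm.1 rfl t ε hm.2
        (fun r hr h => Finset.min'_le _ _ (Finset.mem_filter.2 ⟨hr, h⟩)) hε hpos
      linarith [(hsign ε (stepFun b Q K t - stepFun a P J t) hε).1]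

/-- Summation by parts against a Lipschitz continuous function. -/
lemma abs_sum_sub_sum_le {G : ℝ → ℝ} {M : ℝ} (hM : 0 ≤ M) (hG : LipschitzWith M.toNNReal G)
    (hP : ∀ p ∈ P, p ∈ Ioo (0 : ℝ) 1) (hQ : ∀ q ∈ Q, q ∈ Ioo (0 : ℝ) 1) (c d : ℝ → ℝ)
    (hcd : ∑ p ∈ P, c p = ∑ q ∈ Q, d q) :
    |∑ p ∈ P, G p * c p - ∑ q ∈ Q, G q * d q| ≤ M * ∫ t,
      |∑ p ∈ P, c p * heaviside p t - ∑ q ∈ Q, d q * heaviside q t| ∂unitMeasure := by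
  have hb : ∀ t, |deriv G t| ≤ M := fun t => by
    have := norm_deriv_le_of_lipschitz (x₀ := t) hG
    rwa [Real.coe_toNNReal _ hM] at this
  have hi : Integrable (deriv G) unitMeasure :=
    ⟨(measurable_deriv G).aestronglyMeasurable, HasFiniteIntegral.of_bounded
      (Eventually.of_forall hb)⟩
  -- The boundary term `G 1` is multiplied by the total mass of the weights, so it cancels in the
  -- difference by `hcd`.
  have hval : ∀ p ∈ Ioo (0 : ℝ) 1,
      G p = G 1 - ∫ t, deriv G t * heaviside p t ∂unitMeasure := by
    intro p hp
    rw [integral_mul_heaviside _ ⟨hp.1.le, hp.2.le⟩,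
      (hG.lipschitzOnWith (s := uIcc p 1)).absolutelyContinuousOnInterval.integral_deriv_eq_sub]
    ring
  have hsum : ∀ (R : Finset ℝ) (e : ℝ → ℝ), (∀ r ∈ R, r ∈ Ioo (0 : ℝ) 1) →
      ∑ r ∈ R, G r * e r = G 1 * ∑ r ∈ R, e r -
        ∫ t, deriv G t * ∑ r ∈ R, e r * heaviside r t ∂unitMeasure := by
    intro R e hR
    have h1 : ∀ t, deriv G t * ∑ r ∈ R, e r * heaviside r t =
        ∑ r ∈ R, e r * (deriv G t * heaviside r t) := fun t => by
      rw [Finset.mul_sum]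
      exact Finset.sum_congr rfl fun r _ => by ring
    simp_rw [h1]
    rw [integral_finsetSum _ fun r _ => (integrable_mul_heaviside hi r).const_mul _,
      Finset.mul_sum, ← Finset.sum_sub_distrib]
    refine Finset.sum_congr rfl fun r hr => ?_
    rw [integral_const_mul, hval r (hR r hr)]
    ring
  have hint : ∀ (R : Finset ℝ) (e : ℝ → ℝ),
      Integrable (fun t => ∑ r ∈ R, e r * heaviside r t) unitMeasure := fun R e =>
    integrable_finsetSum _ fun r _ => by
      simpa using (integrable_mul_heaviside (integrable_const (1 : ℝ)) r).const_mul (e r)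
  have hint' : ∀ (R : Finset ℝ) (e : ℝ → ℝ),
      Integrable (fun t => deriv G t * ∑ r ∈ R, e r * heaviside r t) unitMeasure := fun R e =>
    (hint R e).bdd_mul hi.aestronglyMeasurable (Eventually.of_forall hb)
  have heq : ∑ p ∈ P, G p * c p - ∑ q ∈ Q, G q * d q = -∫ t, deriv G t *
      (∑ p ∈ P, c p * heaviside p t - ∑ q ∈ Q, d q * heaviside q t) ∂unitMeasure := by
    rw [hsum P c hP, hsum Q d hQ, hcd]
    simp_rw [mul_sub]
    rw [integral_sub (hint' P c) (hint' Q d)]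
    ring
  rw [heq, abs_neg, ← integral_const_mul, ← Real.norm_eq_abs]
  refine norm_integral_le_of_norm_le (((hint P c).sub (hint Q d)).abs.const_mul M)
    (Eventually.of_forall fun t => ?_)
  rw [norm_mul]
  exact mul_le_mul_of_nonneg_right (hb t) (abs_nonneg _)

end Variation

lemma abs_sub_le_of_ae {G H : ℝ → ℝ} (hG : Continuous G) (hH : Continuous H) {c : ℝ}
    (h : ∀ᵐ t ∂unitMeasure, |G t - H t| ≤ c) {t : ℝ} (ht : t ∈ Ioo (0 : ℝ) 1) :
    |G t - H t| ≤ c := by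
  have := neBot_ae_inf_left ht
  refine le_of_tendsto (f := fun s => |G s - H s|) (x := ae unitMeasure ⊓ 𝓝[<] t) ?_
    (mem_inf_of_left h)
  exact ((hG.sub hH).abs.tendsto t).mono_left (inf_le_right.trans nhdsWithin_le_nhds)

/-! ### Trial points and the threshold radius. -/

section Trial

variable {W : Finset ℤ} {n : ℕ} {a b : ℤ} {P Q : Finset ℝ} {J K : ℝ → ℤ} {x y : L1}

/-- If `y` misses the extremal value on the whole bump, its values in `W` stay at least `η` away
from it. Then `y` is at least as far from `x` as the flattened function, so the latter is feasible
too. -/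
lemma IsBump.exists_le_or_le_predicted {p q : ℝ} {ε : ℤ} (hb : IsBump P J p q ε)
    (h : IsSwitchRep W n a P J x) (hy : IsSwitchRep W n b Q K y) {A : Set L1}
    (hA : switchSpace W n ⊆ A) {gradF : L1 → LInf} {M Δ : ℝ} (hM : ‖gradF x‖ ≤ M)
    (hd : dist y x ≤ Δ) :
    (∃ s ∈ Ioo p q, 0 ≤ ε * (stepFun b Q K s - stepFun a P J s)) ∨
      1 - M * Δ ≤ predicted gradF A x Δ := by
  refine or_iff_not_imp_left.2 fun hcon => ?_
  push Not at hcon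
  obtain ⟨η, hη, hmem, hmin⟩ := hb.exists_height h
  have hp0 := hb.nonneg_left h.mem_Ioo
  have hq1 := hb.right_le_one h.mem_Ioo
  have hη0 : (0 : ℝ) ≤ η := by exact_mod_cast (zero_le_one.trans hη)
  have hle : ∀ s ∈ Ioo p q, (η : ℝ) ≤ |(stepFun b Q K s : ℝ) - stepFun a P J s| := by
    intro s hs
    have h1 := hcon s hs
    rw [hb.stepFun_eq a hs.1 hs.2.le] at h1 ⊢
    have h2 := hmin _ (hy.mem s ⟨hp0.trans_lt hs.1, hs.2.trans_le hq1⟩) (by linarith)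
    have h3 : η ≤ |stepFun b Q K s - stepFun a P J q| := by
      refine h2.trans ((le_abs_self _).trans_eq ?_)
      rw [abs_mul, abs_sub_comm]
      rcases hb.sign with h | h <;> simp [h]
    exact_mod_cast h3
  have hdist : η * (q - p) ≤ dist y x := by
    rw [dist_L1_eq hy.isStep h.isStep]
    have h1 : η * (q - p) = ∫ t, (Ioo p q).indicator (fun _ => (η : ℝ)) t ∂unitMeasure := by
      rw [setIntegral_indicator measurableSet_Ioo, setIntegral_const, smul_eq_mul, mul_comm,
        inter_eq_right.2 (Ioo_subset_Ioo hp0 hq1),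
        Real.volume_real_Ioo_of_le hb.lt.le]
    rw [h1]
    refine integral_mono ((integrable_const _).indicator measurableSet_Ioo)
      ((integrable_stepFun b Q K).sub (integrable_stepFun a P J)).abs fun t => ?_
    by_cases ht : t ∈ Ioo p q
    · rw [indicator_of_mem ht]
      exact hle t ht
    · rw [indicator_of_notMem ht]
      exact abs_nonneg _
  refine le_trans ?_ (hb.le_predicted h hA hM hη hmem hmin (hdist.trans hd))
  have := mul_le_mul_of_nonneg_left (hdist.trans hd) ((norm_nonneg _).trans hM)
  linarith

/-- The change is split at the sum of `|G q| * |K q|`, which combines the gradient at `x` with the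
jumps of `y`. Moving the jumps contributes the constant `M`, changing the gradient contributes `κ`
times the bound `n * D` for the variation. -/
lemma le_predicted_or_abs_criticality_sub_le {gradF : L1 → LInf} {A : Set L1} {κ : ℝ≥0}
    (hκ : LipschitzWith κ gradF) {M : ℝ}
    (hgrad : ∀ w ∈ switchSpace W n, ‖gradF w‖ ≤ M ∧ ∃ G : ℝ → ℝ, LipschitzWith M.toNNReal G ∧
      G =ᵐ[unitMeasure] gradF w ∧ EqOn (contRep (gradF w)) G (Ioo 0 1))
    {D : ℤ} (hD0 : 0 ≤ D) (hD : ∀ k ∈ W, ∀ l ∈ W, |k - l| ≤ D) (hA : switchSpace W n ⊆ A)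
    (hx : x ∈ switchSpace W n) (hy : y ∈ switchSpace W n) {Δ : ℝ}
    (hsol : y ∈ trSolutions gradF A x Δ) (hΔ : M * Δ ≤ 1 / 2) :
    1 / 4 ≤ predicted gradF A x Δ ∨
      |criticality gradF x - criticality gradF y| ≤ (κ * (n * D) + M) * dist x y := by
  refine or_iff_not_imp_left.2 fun hcon => ?_
  rw [not_le] at hcon
  obtain ⟨a, P, J, hxr⟩ := exists_isSwitchRep hx
  obtain ⟨b, Q, K, hyr⟩ := exists_isSwitchRep hy
  obtain ⟨hMx, G, hGL, hG, hGe⟩ := hgrad x hx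
  obtain ⟨hMy, H, hHL, hH, hHe⟩ := hgrad y hy
  have hM : 0 ≤ M := (norm_nonneg _).trans hMx
  have hd : dist y x ≤ Δ := hsol.1.2
  -- The variation difference is an integer. It is `-predicted` minus the gradient term, with
  -- `predicted` in `[0, 1/4)` and the gradient term at most `1/2` in modulus, so it vanishes.
  have hTV : ∑ q ∈ Q, |K q| = ∑ p ∈ P, |J p| := by
    have h1 := predicted_eq hsol
    have h2 := predicted_nonneg (gradF := gradF) (hA hx) (dist_nonneg.trans hd)
    have h3 := abs_le.1 (abs_integral_mul_sub_le (gradF x) x y)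
    have h4 := mul_le_mul hMx hd dist_nonneg hM
    rw [trObjective, hxr.totalVariation_eq, hyr.totalVariation_eq] at h1
    have h5 : ((∑ q ∈ Q, |K q| : ℤ) : ℝ) - (∑ p ∈ P, |J p| : ℤ) < 1 := by linarith [h3.1]
    have h6 : -1 < ((∑ q ∈ Q, |K q| : ℤ) : ℝ) - (∑ p ∈ P, |J p| : ℤ) := by linarith [h3.2]
    have h7 : |(∑ q ∈ Q, |K q|) - (∑ p ∈ P, |J p|)| < 1 := by
      rw [abs_lt]
      exact ⟨by exact_mod_cast h6, by exact_mod_cast h5⟩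
    exact sub_eq_zero.1 (Int.abs_lt_one_iff.1 h7)
  have hbump : ∀ p q ε, IsBump P J p q ε →
      ∃ s ∈ Ioo p q, 0 ≤ ε * (stepFun b Q K s - stepFun a P J s) := fun p q ε hb =>
    -- The alternative would give a predicted reduction of at least `1 - M * Δ ≥ 1/2`.
    (hb.exists_le_or_le_predicted hxr hyr hA hMx hd).resolve_right fun h => by linarith
  have hvar := abs_stepVar_sub_le hxr.mem_Ioo hxr.ne_zero hbump hTV
  have habsL : LipschitzWith M.toNNReal fun t => |G t| := by
    have h := lipschitzWith_one_norm.comp hGL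
    rwa [one_mul] at h
  have h1 : |(∑ p ∈ P, |G p| * |(J p : ℝ)|) - (∑ q ∈ Q, |G q| * |(K q : ℝ)|)| ≤ M * dist x y := by
    refine (abs_sum_sub_sum_le hM habsL hxr.mem_Ioo hyr.mem_Ioo (fun p => |(J p : ℝ)|)
      (fun q => |(K q : ℝ)|) (by exact_mod_cast hTV.symm)).trans ?_
    refine mul_le_mul_of_nonneg_left ?_ hM
    rw [dist_comm, dist_L1_eq hyr.isStep hxr.isStep]
    refine integral_mono_of_nonneg (Eventually.of_forall fun t => abs_nonneg _)
      ((integrable_stepFun b Q K).sub (integrable_stepFun a P J)).abs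
      (Eventually.of_forall fun t => ?_)
    have h2 : ∀ (R : Finset ℝ) (e : ℝ → ℤ),
        ∑ r ∈ R, |(e r : ℝ)| * heaviside r t = (stepVar R e t : ℝ) := fun R e => by
      rw [stepVar, stepFun_cast, Int.cast_zero, zero_add]
      simp only [Int.cast_abs]
    simp only [h2]
    rw [abs_sub_comm]
    exact_mod_cast hvar t
  have h2 : |(∑ q ∈ Q, |G q| * |(K q : ℝ)|) - (∑ q ∈ Q, |H q| * |(K q : ℝ)|)| ≤
      κ * (n * D) * dist x y := by
    have hGH : ∀ t ∈ Ioo (0 : ℝ) 1, |G t - H t| ≤ κ * dist x y := by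
      intro t ht
      refine abs_sub_le_of_ae hGL.continuous hHL.continuous ?_ ht
      filter_upwards [ae_abs_le_norm (gradF x - gradF y), Lp.coeFn_sub (gradF x) (gradF y), hG, hH]
        with s h1 h2 h3 h4
      rw [h2, Pi.sub_apply, ← h3, ← h4, ← dist_eq_norm] at h1
      exact h1.trans (hκ.dist_le_mul x y)
    rw [← Finset.sum_sub_distrib]
    calc |∑ q ∈ Q, (|G q| * |(K q : ℝ)| - |H q| * |(K q : ℝ)|)|
        ≤ ∑ q ∈ Q, (κ * dist x y) * |(K q : ℝ)| := by
          refine (Finset.abs_sum_le_sum_abs _ _).trans (Finset.sum_le_sum fun q hq => ?_)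
          rw [← sub_mul, abs_mul, abs_abs]
          exact mul_le_mul_of_nonneg_right
            ((abs_abs_sub_abs_le _ _).trans (hGH q (hyr.mem_Ioo q hq))) (abs_nonneg _)
      _ = (κ * dist x y) * ((∑ q ∈ Q, |K q| : ℤ) : ℝ) := by
          rw [← Finset.mul_sum]
          push_cast
          rfl
      _ ≤ (κ * dist x y) * (n * D) := by
          refine mul_le_mul_of_nonneg_left ?_ (mul_nonneg κ.2 dist_nonneg)
          exact_mod_cast hyr.sum_abs_jump_le hD0 hD
      _ = κ * (n * D) * dist x y := by ring
  have h3 : criticality gradF x = ∑ p ∈ P, |G p| * |(J p : ℝ)| := by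
    rw [hxr.criticality_eq]
    exact Finset.sum_congr rfl fun p hp => by rw [hGe (hxr.mem_Ioo p hp)]
  have h4 : criticality gradF y = ∑ q ∈ Q, |H q| * |(K q : ℝ)| := by
    rw [hyr.criticality_eq]
    exact Finset.sum_congr rfl fun q hq => by rw [hHe (hyr.mem_Ioo q hq)]
  rw [h3, h4, add_mul]
  refine (abs_sub_le _ (∑ q ∈ Q, |G q| * |(K q : ℝ)|) _).trans ?_
  linarith

/-- The radius up to which the predicted reduction is bounded below by the criticality measure; at
this radius a bump can be flattened. -/
lemma exists_radius {gradF : L1 → LInf} {A : Set L1} {M : ℝ} (hM1 : 1 ≤ M)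
    (hgrad : ∀ w ∈ switchSpace W n, ‖gradF w‖ ≤ M ∧ ∃ G : ℝ → ℝ, LipschitzWith M.toNNReal G ∧
      G =ᵐ[unitMeasure] gradF w ∧ EqOn (contRep (gradF w)) G (Ioo 0 1))
    {D : ℤ} (hD1 : 1 ≤ D) (hD : ∀ k ∈ W, ∀ l ∈ W, |k - l| ≤ D) (hA : switchSpace W n ⊆ A)
    (hx : x ∈ switchSpace W n) :
    ∃ d : ℝ, 0 < d ∧ d ≤ 1 ∧
      (∀ Δ, 0 ≤ Δ → Δ ≤ d → (2 * D * (n + 1) : ℝ)⁻¹ * criticality gradF x * Δ - 2 * M * Δ ^ 2 ≤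
        predicted gradF A x Δ) ∧
      ∀ Δ, d < 1 → d ≤ Δ → 1 - M * d ≤ predicted gradF A x Δ := by
  obtain ⟨a, P, J, h⟩ := exists_isSwitchRep hx
  obtain ⟨hMx, G, hGL, hG, hGe⟩ := hgrad x hx
  have hDr : (1 : ℝ) ≤ D := by exact_mod_cast hD1
  have hD0 : (0 : ℝ) < D := by linarith
  have hM0 : 0 < M := by linarith
  obtain ⟨d, hd0, hd1, hd, hd'⟩ := exists_min_bump P J hD0
  refine ⟨d, hd0, hd1, fun Δ hΔ hΔd => ?_, fun Δ hd1' hdΔ => ?_⟩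
  · set T : ℝ := 2 * D * (n + 1) with hT
    have hn : (0 : ℝ) ≤ n := n.cast_nonneg
    have hT1 : 1 ≤ T := by nlinarith
    have hT0 : 0 < T := by linarith
    have hTV : ((∑ p ∈ P, |J p| : ℤ) : ℝ) ≤ T := by
      have h1 : ((∑ p ∈ P, |J p| : ℤ) : ℝ) ≤ n * D := by
        exact_mod_cast h.sum_abs_jump_le (by linarith) hD
      nlinarith
    have hr0 : 0 ≤ T⁻¹ * Δ := mul_nonneg (inv_nonneg.2 hT0.le) hΔ
    have hTr : T⁻¹ * Δ * T = Δ := by field_simp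
    have h1 := h.le_predicted (Δ := Δ) hA hM0 hGL hG hr0 hD0 hd (by
      refine le_trans ?_ hΔd
      have h2 : 2 * (D : ℝ) ≤ T := by nlinarith
      calc 2 * (D : ℝ) * (T⁻¹ * Δ) ≤ T * (T⁻¹ * Δ) := mul_le_mul_of_nonneg_right h2 hr0
        _ = Δ := by rw [mul_comm, hTr])
      (by
        calc T⁻¹ * Δ * ((∑ p ∈ P, |J p| : ℤ) : ℝ) ≤ T⁻¹ * Δ * T :=
              mul_le_mul_of_nonneg_left hTV hr0
          _ = Δ := hTr)
    have hC : criticality gradF x = ∑ p ∈ P, |G p| * |(J p : ℝ)| := by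
      rw [h.criticality_eq]
      exact Finset.sum_congr rfl fun p hp => by rw [hGe (h.mem_Ioo p hp)]
    rw [← hC] at h1
    have h2 : (T⁻¹ * Δ) ^ 2 * ((∑ p ∈ P, |J p| : ℤ) : ℝ) ≤ Δ ^ 2 := by
      calc (T⁻¹ * Δ) ^ 2 * ((∑ p ∈ P, |J p| : ℤ) : ℝ) ≤ (T⁻¹ * Δ) ^ 2 * T :=
            mul_le_mul_of_nonneg_left hTV (sq_nonneg _)
        _ = T⁻¹ * Δ ^ 2 := by field_simp
        _ ≤ 1 * Δ ^ 2 := mul_le_mul_of_nonneg_right (inv_le_one_of_one_le₀ hT1) (sq_nonneg _)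
        _ = Δ ^ 2 := one_mul _
    have h3 := mul_le_mul_of_nonneg_left h2 (by linarith : (0 : ℝ) ≤ 2 * M)
    linarith
  · obtain ⟨p, q, ε, hb, hdpq⟩ := hd'.resolve_left hd1'.ne
    obtain ⟨η, hη, hmem, hmin⟩ := hb.exists_height h
    have hηD : (η : ℝ) ≤ D := by
      have h1 := hD _ (hb.stepFun_right_mem h) _ hmem
      rw [sub_sub_cancel] at h1
      have h2 : η ≤ D := by
        refine le_trans ?_ h1
        refine (le_abs_self _).trans_eq ?_
        rw [abs_mul]
        rcases hb.sign with h | h <;> simp [h]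
      exact_mod_cast h2
    have hηd : η * (q - p) ≤ d := by
      rw [hdpq]
      exact mul_le_mul_of_nonneg_right hηD (sub_pos.2 hb.lt).le
    refine le_trans ?_ (hb.le_predicted h hA hMx hη hmem hmin (hηd.trans hdΔ))
    have := mul_le_mul_of_nonneg_left hηd hM0.le
    linarith

end Trial

/-! ### Actual versus predicted reduction, and the conclusion. -/

/-- The variation terms enter both reductions identically and cancel; only the Taylor remainder of
`F` is left. -/
lemma abs_reduction_sub_predicted_le {F : L1 → ℝ} {gradF : L1 → LInf} (hF : IsGradient F gradF)
    {κ : ℝ≥0} (hκ : LipschitzWith κ gradF) {A : Set L1} {x y : L1} {Δ : ℝ}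
    (hy : y ∈ trSolutions gradF A x Δ) :
    |(objective F x - objective F y) - predicted gradF A x Δ| ≤ κ * Δ ^ 2 := by
  have h1 := taylor_bound hF hκ x y
  have h2 : (objective F x - objective F y) - predicted gradF A x Δ =
      -(F y - F x - ∫ t, gradF x t * (y t - x t) ∂unitMeasure) := by
    rw [predicted_eq hy, objective, objective, trObjective]
    ring
  rw [h2, abs_neg]
  refine h1.trans (mul_le_mul_of_nonneg_left ?_ κ.2)
  exact pow_le_pow_left₀ dist_nonneg hy.1.2 2

/-- All errors are quadratic, and `s = 1/2` is just one admissible exponent. The restriction to `Δ ≤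
1` is the reason for truncating the threshold radius at 1. -/
lemma sq_le_rpow {Δ : ℝ} (h0 : 0 ≤ Δ) (h1 : Δ ≤ 1) : Δ ^ 2 ≤ Δ ^ ((1 : ℝ) + 1 / 2) := by
  rcases h0.eq_or_lt with rfl | h
  · rw [Real.zero_rpow (by norm_num)]
    norm_num
  · rw [← Real.rpow_natCast]
    exact Real.rpow_le_rpow_of_exponent_ge h h1 (by norm_num)

end

end IntegerControl

open IntegerControl

/-- `A` is the feasible set of the control problem and of the trust-region subproblems; the choices
`A = switchSpace W nmax` and `A = BVW W` are both covered. -/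
theorem mainTheorem3 (W : Finset ℤ) (nmax : ℕ)
    (F : IntegerControl.L1 → ℝ) (gradF : IntegerControl.L1 → IntegerControl.LInf)
    (hF : IntegerControl.GeneralAssumption F gradF (IntegerControl.switchSpace W nmax) ∞)
    (A : Set IntegerControl.L1) (hXA : IntegerControl.switchSpace W nmax ⊆ A)
    (hA : A ⊆ IntegerControl.BVW W)
    (σ : ℝ) (hσ₀ : 0 < σ) (hσ₁ : σ < 1) :
    IntegerControl.JumpNonsmoothness (IntegerControl.switchSpace W nmax)
      (IntegerControl.criticality gradF) (IntegerControl.objective F)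
      (IntegerControl.predicted gradF A) (IntegerControl.trSolutions gradF A) σ := by
  classical
  obtain ⟨M, hM1, hgrad⟩ := exists_gradient_bound hF
  obtain ⟨κ, hκ⟩ := hF.lipschitz
  have hM0 : 0 < M := by linarith
  have hκ0 : (0 : ℝ) ≤ κ := κ.2
  have hσ : 0 < 1 - σ := by linarith
  obtain ⟨D, hD1, hD⟩ : ∃ D : ℤ, 1 ≤ D ∧ ∀ k ∈ W, ∀ l ∈ W, |k - l| ≤ D := by
    refine ⟨1 + ∑ k ∈ W, ∑ l ∈ W, |k - l|, ?_, fun k hk l hl => ?_⟩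
    · linarith [Finset.sum_nonneg fun k (_ : k ∈ W) =>
        Finset.sum_nonneg fun l (_ : l ∈ W) => abs_nonneg (k - l)]
    · have h1 := Finset.single_le_sum (f := fun l => |k - l|) (fun l _ => abs_nonneg _) hl
      have h2 := Finset.single_le_sum (f := fun k => ∑ l ∈ W, |k - l|)
        (fun k _ => Finset.sum_nonneg fun l _ => abs_nonneg _) hk
      linarith
  have hDr : (1 : ℝ) ≤ D := by exact_mod_cast hD1
  refine ⟨fun x hx => monotoneOn_predicted (hXA hx), ?_⟩
  have hrad := fun x (hx : x ∈ switchSpace W nmax) => exists_radius hM1 hgrad hD1 hD hXA hx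
  choose! Δa hΔa0 hΔa1 hlow hflat using hrad
  set c₀ : ℝ := (2 * D * (nmax + 1) : ℝ)⁻¹ with hc₀
  have hc₀0 : 0 < c₀ := by positivity
  have hlow' : ∀ x ∈ switchSpace W nmax, ∀ Δ, 0 ≤ Δ → Δ ≤ Δa x →
      c₀ * criticality gradF x * Δ - 2 * M * Δ ^ ((1 : ℝ) + 1 / 2) ≤ predicted gradF A x Δ := by
    intro x hx Δ h0 h1
    have h2 := hlow x hx Δ h0 h1
    have h3 := mul_le_mul_of_nonneg_left (sq_le_rpow h0 (h1.trans (hΔa1 x hx)))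
      (by linarith : (0 : ℝ) ≤ 2 * M)
    linarith
  -- After multiplication by `1 - σ` the extra term is `2 * κ / (1 - σ)`. This covers the Taylor
  -- error at a trial point as well as the bound `κ / (1 - σ)`, in units of `Δ ^ (1 + s)`, for the
  -- predicted reduction when the iterate does not move.
  set c₂ : ℝ := 2 * M + 2 * κ / (1 - σ) ^ 2 with hc₂
  have hc₁₂ : 2 * M ≤ c₂ := by
    have : 0 ≤ 2 * κ / (1 - σ) ^ 2 := by positivity
    linarith
  -- The first entry leaves a predicted reduction of at least `1/2` after flattening. The second
  -- makes the Taylor error at most `(1 - σ) / 4`, half of the resulting `(1 - σ) / 2`; the other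
  -- half is `δ`.
  set Δb : ℝ := min (1 / (2 * M)) ((1 - σ) / (4 * (κ + 1))) with hΔb
  have hΔb0 : 0 < Δb := lt_min (by positivity) (by positivity)
  have hΔbM : M * Δb ≤ 1 / 2 := by
    calc M * Δb ≤ M * (1 / (2 * M)) := mul_le_mul_of_nonneg_left (min_le_left _ _) hM0.le
      _ = 1 / 2 := by field_simp
  have hΔb1 : Δb < 1 := by nlinarith
  have hΔbκ : κ * Δb ^ 2 ≤ (1 - σ) / 4 := by
    have h1 : (κ + 1) * Δb ≤ (1 - σ) / 4 := by
      calc (κ + 1) * Δb ≤ (κ + 1) * ((1 - σ) / (4 * (κ + 1))) :=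
            mul_le_mul_of_nonneg_left (min_le_right _ _) (by linarith)
        _ = (1 - σ) / 4 := by field_simp
    have h2 : κ * Δb ^ 2 ≤ κ * Δb := by
      refine mul_le_mul_of_nonneg_left ?_ hκ0
      nlinarith
    linarith
  have hpred : ∀ x ∈ switchSpace W nmax, ∀ Δ, Δa x ≤ Δ → Δa x ≤ Δb →
      1 / 2 ≤ predicted gradF A x Δ := by
    intro x hx Δ h1 h2
    have h3 := hflat x hx Δ (h2.trans_lt hΔb1) h1
    have h4 := mul_le_mul_of_nonneg_left h2 hM0.le
    linarith
  refine ⟨c₀, 2 * M, 1 / 2, Δa, hc₀0, by linarith, by norm_num, by norm_num,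
    fun x hx => (hΔa0 x hx).le, hlow', c₂, Δb, (1 - σ) / 4, hc₁₂, hΔb0, by linarith, ?_,
    1 / (2 * M), κ * (nmax * D) + M, by positivity, by positivity, ?_⟩
  · intro Δmax x y Δ _ hrun hX n
    have hsol := hrun.trial n
    -- Feasibility of the trial point already forces a nonnegative radius, so neither an induction
    -- along the run nor `Δmax` is needed.
    have hΔ0 : 0 ≤ Δ n := dist_nonneg.trans hsol.1.2
    have hred := abs_reduction_sub_predicted_le hF.gradient hκ hsol
    have hnn := predicted_nonneg (gradF := gradF) (hXA (hX n)) hΔ0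
    have hstep : x (n + 1) = y n ∨ (x (n + 1) = x n ∧ (1 - σ) * predicted gradF A (x n) (Δ n) ≤
        |(objective F (x n) - objective F (y n)) - predicted gradF A (x n) (Δ n)|) := by
      by_cases h0 : predicted gradF A (x n) (Δ n) = 0
      · exact Or.inr ⟨(hrun.terminate n h0).1, by rw [h0, mul_zero]; exact abs_nonneg _⟩
      · rcases le_or_gt (σ * predicted gradF A (x n) (Δ n))
          (objective F (x n) - objective F (y n)) with h | h
        · exact Or.inl (hrun.accept n h0 h).1
        · refine Or.inr ⟨(hrun.reject n h0 h).1, ?_⟩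
          rw [abs_sub_comm]
          refine le_trans ?_ (le_abs_self _)
          linarith
    -- If the iterate does not move, either the predicted reduction is zero or the step was
    -- rejected. Rejection means that actual and predicted reduction differ by more than `(1 - σ)`
    -- times the latter, which the Taylor error bounds.
    have hcase : ∀ z, z = x (n + 1) ∨ z = y n → z = y n ∨ (z = x n ∧
        (1 - σ) * predicted gradF A (x n) (Δ n) ≤ κ * Δ n ^ 2) := by
      rintro z (rfl | rfl)
      · rcases hstep with h | ⟨h, h'⟩
        · exact Or.inl h
        · exact Or.inr ⟨h, h'.trans hred⟩
      · exact Or.inl rfl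
    refine ⟨fun z hz hΔ => ?_, fun hΔ => ?_, fun z hz hΔ hΔ' => ?_⟩
    · have h1 := hlow' _ (hX n) _ hΔ0 hΔ
      have h2 := sq_le_rpow hΔ0 (hΔ.trans (hΔa1 _ (hX n)))
      set R : ℝ := Δ n ^ ((1 : ℝ) + 1 / 2) with hR
      have hR0 : 0 ≤ R := (sq_nonneg _).trans h2
      set p := predicted gradF A (x n) (Δ n) with hp
      have h3 : c₀ * criticality gradF (x n) * Δ n - c₂ * R ≤ p - 2 * κ / (1 - σ) ^ 2 * R := by
        rw [hc₂]; linarith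
      have h4 := mul_le_mul_of_nonneg_left h3 hσ.le
      have h5 : (1 - σ) * (2 * κ / (1 - σ) ^ 2 * R) = 2 * κ * R / (1 - σ) := by
        field_simp
      have h6 : κ * Δ n ^ 2 ≤ κ * R := mul_le_mul_of_nonneg_left h2 hκ0
      have h7 : κ * R ≤ κ * R / (1 - σ) := by
        rw [le_div_iff₀ hσ]
        nlinarith [mul_nonneg hκ0 hR0]
      have h8 : 2 * κ * R / (1 - σ) = κ * R / (1 - σ) + κ * R / (1 - σ) := by ring
      rcases hcase z hz with rfl | ⟨rfl, h9⟩
      · rw [remainder, ← hp]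
        have := mul_nonneg hκ0 hR0
        linarith
      · rw [remainder, ← hp, sub_self, zero_sub, abs_neg, abs_of_nonneg hnn]
        have h10 : p ≤ κ * R / (1 - σ) := by
          rw [le_div_iff₀ hσ]
          linarith
        have := mul_nonneg hκ0 hR0
        linarith
    · have h1 := hpred _ (hX n) (Δ n) (hΔ.trans (min_le_left _ _)) (hΔ.trans (min_le_right _ _))
      linarith
    · have h1 := hpred _ (hX n) (Δ n) hΔ (hΔ.trans hΔ')
      have h2 : κ * Δ n ^ 2 ≤ (1 - σ) / 4 :=
        (mul_le_mul_of_nonneg_left (pow_le_pow_left₀ hΔ0 hΔ' 2) hκ0).trans hΔbκ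
      have h3 := mul_le_mul_of_nonneg_left h1 hσ.le
      rcases hcase z hz with rfl | ⟨rfl, h9⟩
      · rw [remainder]
        linarith
      -- An unmoved iterate is impossible here: `(1 - σ) / 2` would be at most `(1 - σ) / 4`.
      · linarith
  · intro Δmax x y Δ _ hrun hX n z hzX hz _ hΔ
    have hsol := hrun.trial n
    have hΔM : M * Δ n ≤ 1 / 2 := by
      calc M * Δ n ≤ M * (1 / (2 * M)) := mul_le_mul_of_nonneg_left hΔ hM0.le
        _ = 1 / 2 := by field_simp
    have hz' : z = x n ∨ z = y n := by
      rcases hz with rfl | rfl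
      · by_cases h0 : predicted gradF A (x n) (Δ n) = 0
        · exact Or.inl (hrun.terminate n h0).1
        · rcases le_or_gt (σ * predicted gradF A (x n) (Δ n))
            (objective F (x n) - objective F (y n)) with h | h
          · exact Or.inr (hrun.accept n h0 h).1
          · exact Or.inl (hrun.reject n h0 h).1
      · exact Or.inr rfl
    rcases hz' with rfl | rfl
    · right
      simp
    -- The threshold `1/4` for the predicted reduction exceeds `δ = (1 - σ) / 4`.
    · refine (le_predicted_or_abs_criticality_sub_le hκ hgrad (by linarith) hD hXA (hX n) hzX hsol
        hΔM).imp (fun h => ?_) id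
      linarith
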